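/- Let $0<a_1\le a_2\le\cdots$ be real numbers with $a_n\to\infty$, let $C>0$, and put $\Theta_n=\{\theta\in\mathbb R^n:\sum_{i=1}^n a_i^2\theta_i^2\le C\}$. Let $m=m_n\ge 1$ be integers with $m_n=O(n)$, and write $v_k=1/k$. For $\theta\in\mathbb R^n$ let $X\sim N(\theta,v_nI_n)$ and $\tilde X\sim N(\theta,v_mI_n)$ be independent, and let $p(\tilde x\mid\theta)$ be the density of $\tilde X$. A predictive density is a jointly measurable function $\hat p(\tilde x\mid x)\ge 0$ on $\mathbb R^n\times\mathbb R^n$ with $\int\hat p(\tilde x\mid x)\,d\tilde x=1$ for every $x$; its Kullback–Leibler risk is $$R(\theta,\hat p)=\frac1m\,E_{X,\tilde X\mid\theta}\log\frac{p(\tilde X\mid\theta)}{\hat p(\tilde X\mid X)}\in[0,\infty].$$ Let $R(\Theta_n)=\inf_{\hat p}\sup_{\theta\in\Theta_n}R(\theta,\hat p)$, the infimum being over all predictive densities, and let $R_L(\Theta_n)=\inf_S\sup_{\theta\in\Theta_n}R(\theta,\hat p_S)$, where $S$ ranges over the diagonal matrices $\operatorname{diag}(s_1,\dots,s_n)$ with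 $s_i\ge0$ and $\hat p_S$ is the Bayes predictive density under the prior $N(0,S)$ on $\mathbb R^n$. For each $n\ge1$ let $\tilde\lambda=\tilde\lambda_n$ be a solution of $$\sum_{i=1}^n a_i^2\Big[(v_n-v_{n+m})\sqrt{1+\tfrac{4\tilde\lambda/a_i^2}{v_n-v_{n+m}}}-(v_n+v_{n+m})\Big]_+=2C ,$$ where $[x]_+=\max(x,0)$, and let $$\tilde\theta_i^2=\tfrac12\Big[(v_n-v_{n+m})\sqrt{1+\tfrac{4\tilde\lambda/a_i^2}{v_n-v_{n+m}}}-(v_n+v_{n+m})\Big]_+,\qquad 1\le i\le n.$$ Suppose that $\log(1/v_n)\sum_{i=1}^n a_i^4\tilde\theta_i^4\to0$ as $n\to\infty$. Then $$\lim_{n\to\infty}\frac{R(\Theta_n)}{R_L(\Theta_n)}=1 .$$ Moreover, the Gaussian prior $\pi_{\tilde V}=N(0,\tilde V)$ with $\tilde V=\operatorname{diag}(\tilde\theta_1^2,\dots,\tilde\theta_n^2)$ is asymptotically least favorable: writing $r(\pi)=\inf_{\hat p}\int R(\theta,\hat p)\,\pi(d\theta)$ for the Bayes risk of a prior $\pi$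 on $\mathbb R^n$, $$\lim_{n\to\infty}\frac{r(\pi_{\tilde V})}{R(\Theta_n)}=1\qquad\text{and}\qquad \lim_{n\to\infty}\frac{r(\pi_{\tilde V})}{\sup_{\pi(\Theta_n)=1}r(\pi)}=1,$$ the supremum being over all Borel probability measures $\pi$ on $\mathbb R^n$ with $\pi(\Theta_n)=1$. -/

import Mathlib

open Filter Topology MeasureTheory ProbabilityTheory Asymptotics
open scoped NNReal ENNReal BigOperators

noncomputable section

namespace KLMinimax

/-- The noise level `v_k = 1 / k`. -/
def v (k : ℕ) : ℝ≥0 := 1 / (k : ℝ≥0)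

/-- The density of `N(θ, w I_n)` at the point `x` of `ℝⁿ`. -/
def gaussDensity {n : ℕ} (w : ℝ≥0) (θ x : Fin n → ℝ) : ℝ :=
  ∏ i, gaussianPDFReal (θ i) w (x i)

/-- The law `N(θ, diag (w_1, …, w_n))` on `ℝⁿ`; a coordinate with `w_i = 0` is a point mass. -/
def gaussLaw {n : ℕ} (θ : Fin n → ℝ) (w : Fin n → ℝ≥0) : Measure (Fin n → ℝ) :=
  Measure.pi fun i => gaussianReal (θ i) (w i)

/-- The expectation of an extended-real-valued function, `E g⁺ - E g⁻`, with values in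
`[-∞, ∞]`. -/
def extExpect {Ω : Type*} [MeasurableSpace Ω] (μ : Measure Ω) (g : Ω → EReal) : EReal :=
  ((∫⁻ ω, (g ω).toENNReal ∂μ : ℝ≥0∞) : EReal) - ((∫⁻ ω, (-g ω).toENNReal ∂μ : ℝ≥0∞) : EReal)

/-- `q x y` is a predictive density of `y` given `x`: jointly measurable, non-negative, and of
integral one in `y` for every `x`. -/
structure IsPredictiveDensity {n : ℕ} (q : (Fin n → ℝ) → (Fin n → ℝ) → ℝ) : Prop where
  measurable : Measurable (Function.uncurry q)
  nonneg : ∀ x y, 0 ≤ q x y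
  integral_eq_one : ∀ x, ∫ y, q x y = 1

/-- The average Kullback–Leibler risk
`R(θ, q) = (1 / m) E log (p(X' | θ) / q(X' | X))`, where `X ~ N(θ, v_n I_n)` and
`X' ~ N(θ, v_m I_n)` are independent. The logarithm is `+∞` where `q` vanishes. The expectation of
its negative part is at most one for a predictive density `q`, so the risk is a well-defined
element of `[0, ∞]`. -/
def risk (n m : ℕ) (θ : Fin n → ℝ) (q : (Fin n → ℝ) → (Fin n → ℝ) → ℝ) : EReal :=
  ((1 / (m : ℝ) : ℝ) : EReal) *
    extExpect ((gaussLaw θ fun _ => v n).prod (gaussLaw θ fun _ => v m))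
      fun z => ENNReal.log
        (ENNReal.ofReal (gaussDensity (v m) θ z.2) / ENNReal.ofReal (q z.1 z.2))

/-- The ellipsoid `Θ(C)` in `ℝⁿ`. The weights `a_1, a_2, …` are
`a 0, a 1, …` here. -/
def ellipsoid (a : ℕ → ℝ) (C : ℝ) (n : ℕ) : Set (Fin n → ℝ) :=
  {θ | ∑ i : Fin n, a i ^ 2 * θ i ^ 2 ≤ C}

/-- The minimax risk `R(Θ)` over all predictive densities. -/
def minimaxRisk (a : ℕ → ℝ) (C : ℝ) (n m : ℕ) : EReal :=
  ⨅ (q : (Fin n → ℝ) → (Fin n → ℝ) → ℝ) (_ : IsPredictiveDensity q),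
    ⨆ θ ∈ ellipsoid a C n, risk n m θ q

/-- The Gaussian prior `N(0, S)`, `S = diag (s_1, …, s_n)`. -/
def gaussPrior {n : ℕ} (s : Fin n → ℝ≥0) : Measure (Fin n → ℝ) := gaussLaw 0 s

/-- The linear predictive density: the Bayes predictive density under the prior `N(0, S)`. -/
def linearDensity (n m : ℕ) (s : Fin n → ℝ≥0) (x y : Fin n → ℝ) : ℝ :=
  (∫ θ, gaussDensity (v n) θ x * gaussDensity (v m) θ y ∂gaussPrior s) /
    ∫ θ, gaussDensity (v n) θ x ∂gaussPrior s

/-- The linear minimax risk `R_L(Θ)`. -/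
def linearMinimaxRisk (a : ℕ → ℝ) (C : ℝ) (n m : ℕ) : EReal :=
  ⨅ s : Fin n → ℝ≥0, ⨆ θ ∈ ellipsoid a C n, risk n m θ (linearDensity n m s)

/-- The bracket `[(v_n - v_{n+m}) √(1 + (4 l / a_i²) / (v_n - v_{n+m})) - (v_n + v_{n+m})]₊`, with
`b` in the place of `a_i`. -/
def bracket (n m : ℕ) (l b : ℝ) : ℝ :=
  max (((v n : ℝ) - v (n + m)) * √(1 + (4 * l / b ^ 2) / ((v n : ℝ) - v (n + m)))
    - ((v n : ℝ) + v (n + m))) 0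

/-- `l` is a solution of the equation that defines the multiplier. -/
def IsMultiplier (a : ℕ → ℝ) (C : ℝ) (n m : ℕ) (l : ℝ) : Prop :=
  ∑ i : Fin n, a i ^ 2 * bracket n m l (a i) = 2 * C

/-- The numbers `θ̃_i²`, for the multiplier `l`. -/
def thetaSq (a : ℕ → ℝ) (n m : ℕ) (l : ℝ) (i : Fin n) : ℝ≥0 :=
  Real.toNNReal (1 / 2 * bracket n m l (a i))

/-- The Bayes risk of the prior `π`: the least average risk of a predictive density. -/
def bayesRisk (n m : ℕ) (π : Measure (Fin n → ℝ)) : EReal :=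
  ⨅ (q : (Fin n → ℝ) → (Fin n → ℝ) → ℝ) (_ : IsPredictiveDensity q),
    extExpect π fun θ => risk n m θ q

/-- The largest Bayes risk of a prior that is supported on the ellipsoid. -/
def maxBayesRisk (a : ℕ → ℝ) (C : ℝ) (n m : ℕ) : EReal :=
  ⨆ (π : Measure (Fin n → ℝ)) (_ : IsProbabilityMeasure π) (_ : π (ellipsoid a C n) = 1),
    bayesRisk n m π

/-- Priors `π_n` on `ℝⁿ` are asymptotically least favorable for the ellipsoids: their Bayes risk is
asymptotically equivalent to the minimax risk, and also to the largest Bayes risk of a prior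
supported on the ellipsoid. -/
def AsympLeastFavorable (a : ℕ → ℝ) (C : ℝ) (m : ℕ → ℕ)
    (π : (n : ℕ) → Measure (Fin n → ℝ)) : Prop :=
  Tendsto (fun n => bayesRisk n (m n) (π n) / minimaxRisk a C n (m n)) atTop (𝓝 1) ∧
    Tendsto (fun n => bayesRisk n (m n) (π n) / maxBayesRisk a C n (m n)) atTop (𝓝 1)

end KLMinimax

end

/-!
Write `v = v_n` and `t = v_m`. The proof sandwiches all the risks between multiples of one number
`L`, the Bayes risk `(1 / 2m) ∑ log (1 + w_i / t)` of the prior `N(0, Ṽ)`, where `w_i` is the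
posterior variance of the `i`-th coordinate.

*Upper bound.* By conjugacy the linear densities are products of normal densities, so that their
risk is an explicit affine function of the `θ_i ^ 2` (`hasKLRisk_bayesDensity`). The equation for
the multiplier says that `Ṽ` satisfies the first-order conditions for the maximization of the
Bayes risk over the ellipsoid (`slope_thetaSq`). Hence the linear density for `N(0, Ṽ)` has risk
at most `L` on the ellipsoid, and `maxBayes ≤ minimax ≤ linear minimax ≤ L`.

*Lower bound.* The prior `N(0, (1 - δ) Ṽ)`, conditioned on the ellipsoid `A`, is a competitor in
the largest Bayes risk. By Chebyshev's inequality the conditioning loses a mass `ε` of order `δ⁻²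
∑ a_i ^ 4 θ̃_i ^ 4`, which tends to zero for fixed `δ`. It remains to see that the conditioning
costs only a small fraction of the Bayes risk, although `L` itself may be small. In comparison
with the Gaussian prior, the conditioning loses the information that the future observation
provides on the event `A` beyond that of the first observation
(`integral_cond_sub_le_extExpect_klRisk`). This information is at most `- log (1 - ε)`, and it is
also at most a `χ²` divergence, which by the Cauchy–Schwarz inequality is at most of order `ε`
times the `χ²` information between the future observation and the mean (`restrict_chiSq_le`). For
a Gaussian prior with Bayes risk `L'` that last quantity equals `exp (2 m L') - 1`
(`lintegral_sqDensity_div_gaussPrior`), so the smaller of the two bounds is of order `ε m L'`, for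
small and for large `m L'` alike (`min_information_le`). The second moments of the conditioned
prior are controlled by the fourth moments of the Gaussian, and letting `n → ∞` and then `δ → 0`
finishes the proof.
-/

noncomputable section

namespace KLMinimax

/-! ### Products of Gaussian densities -/

/-- Two products of normal densities are proportional, with the factor `k`, if their exponents agree
and the products of their variances have the ratio `k ^ 2`. -/
lemma gaussianPDFReal_mul_eq {a b c d : ℝ≥0} {k μ₁ μ₂ μ₃ μ₄ x₁ x₂ x₃ x₄ : ℝ}
    (hc : c ≠ 0) (hd : d ≠ 0) (ha : a ≠ 0) (hb : b ≠ 0)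
    (hk : 0 ≤ k) (hvar : (c * d : ℝ) = k ^ 2 * (a * b))
    (hexp : (x₁ - μ₁) ^ 2 / (2 * a) + (x₂ - μ₂) ^ 2 / (2 * b)
      = (x₃ - μ₃) ^ 2 / (2 * c) + (x₄ - μ₄) ^ 2 / (2 * d)) :
    gaussianPDFReal μ₁ a x₁ * gaussianPDFReal μ₂ b x₂
      = k * (gaussianPDFReal μ₃ c x₃ * gaussianPDFReal μ₄ d x₄) := by
  have hc' : (0 : ℝ) < c := by positivity
  have hd' : (0 : ℝ) < d := by positivity
  have ha' : (0 : ℝ) < a := by positivity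
  have hb' : (0 : ℝ) < b := by positivity
  have hsq : √(2 * Real.pi * c) * √(2 * Real.pi * d)
      = k * (√(2 * Real.pi * a) * √(2 * Real.pi * b)) := by
    rw [← Real.sqrt_mul (by positivity), ← Real.sqrt_mul (by positivity),
      ← Real.sqrt_sq hk, ← Real.sqrt_mul (by positivity)]
    congr 1
    linear_combination (4 * Real.pi ^ 2) * hvar
  have hk0 : k ≠ 0 := by
    rintro rfl
    have : (c * d : ℝ) = 0 := by simpa using hvar
    exact absurd this (by positivity)
  have hpi := Real.pi_pos
  have h1 : 0 < √(2 * Real.pi * a) := by positivity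
  have h2 : 0 < √(2 * Real.pi * b) := by positivity
  have h3 : 0 < √(2 * Real.pi * c) := by positivity
  have h4 : 0 < √(2 * Real.pi * d) := by positivity
  simp only [gaussianPDFReal]
  have e : ∀ p q r t : ℝ, p * Real.exp q * (r * Real.exp t) = p * r * Real.exp (q + t) := by
    intros; rw [Real.exp_add]; ring
  rw [e, e, ← mul_assoc]
  congr 1
  · rw [← mul_inv, ← mul_inv, hsq]
    field_simp
  · congr 1
    rw [neg_div, neg_div, neg_div, neg_div]
    linarith

/-- Bayes' rule for a normal mean: the prior `N(μ, s)` times the likelihood of one observation of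
variance `r` is the marginal density of the observation times the normal posterior. The prior
variance `s = 0`, a point mass, is included. -/
lemma integral_likelihood_mul_gaussianReal (μ x : ℝ) (s : ℝ≥0) {r : ℝ≥0} (hr : r ≠ 0)
    (F : ℝ → ℝ) :
    ∫ θ, gaussianPDFReal θ r x * F θ ∂gaussianReal μ s
      = gaussianPDFReal μ (s + r) x *
        ∫ θ, F θ ∂gaussianReal ((r * μ + s * x) / (s + r)) (s * r / (s + r)) := by
  have hr' : (0 : ℝ) < r := by positivity
  rcases eq_or_ne s 0 with rfl | hs
  · have : (r * μ + ((0 : ℝ≥0) : ℝ) * x) / (((0 : ℝ≥0) : ℝ) + r) = μ := by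
      simp [hr'.ne']
    rw [this]
    simp [gaussianReal_zero_var]
  · have hs' : (0 : ℝ) < s := by positivity
    have hw : s * r / (s + r) ≠ 0 := by positivity
    rw [integral_gaussianReal_eq_integral_smul hs, integral_gaussianReal_eq_integral_smul hw,
      ← integral_const_mul]
    refine integral_congr_ae (ae_of_all _ fun θ => ?_)
    have := gaussianPDFReal_mul_eq (a := s) (b := r) (c := s + r) (d := s * r / (s + r)) (k := 1)
      (μ₁ := μ) (x₁ := θ) (μ₂ := θ) (x₂ := x) (μ₃ := μ) (x₃ := x)
      (μ₄ := (r * μ + s * x) / (s + r)) (x₄ := θ) (by positivity) hw hs hr zero_le_one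
      (by push_cast; field_simp) (by push_cast; field_simp; ring)
    simp only [smul_eq_mul]
    rw [one_mul] at this
    linear_combination F θ * this

lemma integral_likelihood_gaussianReal (μ x : ℝ) (s : ℝ≥0) {r : ℝ≥0} (hr : r ≠ 0) :
    ∫ θ, gaussianPDFReal θ r x ∂gaussianReal μ s = gaussianPDFReal μ (s + r) x := by
  simpa using integral_likelihood_mul_gaussianReal μ x s hr (fun _ => 1)

/-- The weight of the observation in the posterior mean for the prior `N(0, s)`. -/
def shrink (r s : ℝ≥0) : ℝ := s / (s + r)

/-- The posterior variance for the prior `N(0, s)` and an observation of variance `r`. -/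
def postVar (r s : ℝ≥0) : ℝ≥0 := s * r / (s + r)

/-- The density of a future observation of variance `t` under the posterior given an observation
`x` of variance `r`. -/
def predPDF (r t s : ℝ≥0) (x y : ℝ) : ℝ := gaussianPDFReal (shrink r s * x) (postVar r s + t) y

/-- The normal density proportional to the posterior mean of `p(y ∣ θ) ^ 2` divided by the
predictive density. -/
def tiltPDF (r t s : ℝ≥0) (x y : ℝ) : ℝ :=
  gaussianPDFReal (shrink r s * x)
    ((postVar r s + t / 2) * (postVar r s + t) / (t / 2)) y

/-- The ratio `w / t` of the posterior variance to the variance of the future observation. It is the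
`χ²` information between the future observation and the mean, given the first observation. -/
def infoRatio (r t s : ℝ≥0) : ℝ := postVar r s / t

lemma integral_joint_gaussianReal (x y : ℝ) (s : ℝ≥0) {r t : ℝ≥0} (hr : r ≠ 0) (ht : t ≠ 0) :
    ∫ θ, gaussianPDFReal θ r x * gaussianPDFReal θ t y ∂gaussianReal 0 s
      = gaussianPDFReal 0 (s + r) x * predPDF r t s x y := by
  rw [integral_likelihood_mul_gaussianReal 0 x s hr, integral_likelihood_gaussianReal _ _ _ ht]
  simp only [predPDF, shrink, postVar]
  congr 2
  ring

lemma integral_joint_sq_gaussianReal (x y : ℝ) (s : ℝ≥0) {r t : ℝ≥0} (hr : r ≠ 0)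
    (ht : t ≠ 0) :
    ∫ θ, gaussianPDFReal θ r x * gaussianPDFReal θ t y ^ 2 ∂gaussianReal 0 s
      = gaussianPDFReal 0 (s + r) x *
        ((1 + infoRatio r t s) * (tiltPDF r t s x y * predPDF r t s x y)) := by
  have ht2 : t / 2 ≠ 0 := by positivity
  have htr : (0 : ℝ) < t := by positivity
  have hsq : ∀ θ, gaussianPDFReal θ t y ^ 2
      = gaussianPDFReal 0 (2 * t) 0 * gaussianPDFReal θ (t / 2) y := by
    intro θ
    rw [sq, ← one_mul (gaussianPDFReal 0 (2 * t) 0 * gaussianPDFReal θ (t / 2) y)]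
    exact gaussianPDFReal_mul_eq (by positivity) ht2 ht ht zero_le_one
      (by push_cast; field_simp) (by push_cast; field_simp; ring)
  rw [integral_likelihood_mul_gaussianReal 0 x s hr]
  simp_rw [hsq]
  rw [integral_const_mul, integral_likelihood_gaussianReal _ _ _ ht2]
  have hm : (r * 0 + s * x) / ((s : ℝ) + r) = shrink r s * x := by simp only [shrink]; ring
  have hw : s * r / (s + r) = postVar r s := rfl
  rw [hm, hw]
  congr 1
  have hwn : (0 : ℝ) ≤ postVar r s := by positivity
  have hpos : postVar r s + t ≠ 0 := by positivity
  have hpos2 : postVar r s + t / 2 ≠ 0 := by positivity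
  refine gaussianPDFReal_mul_eq (by positivity) hpos (by positivity) hpos2
    (by unfold infoRatio; positivity) ?_ ?_
  · simp only [infoRatio]; push_cast; field_simp; ring
  · push_cast; field_simp; ring

/-! ### Gaussian densities on `ℝⁿ` and their mixtures -/

section GaussDensity

variable {n : ℕ}

lemma gaussDensity_pos {r : ℝ≥0} (hr : r ≠ 0) (θ x : Fin n → ℝ) : 0 < gaussDensity r θ x :=
  Finset.prod_pos fun i _ => gaussianPDFReal_pos (θ i) r (x i) hr

lemma gaussDensity_nonneg (r : ℝ≥0) (θ x : Fin n → ℝ) : 0 ≤ gaussDensity r θ x :=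
  Finset.prod_nonneg fun i _ => gaussianPDFReal_nonneg (θ i) r (x i)

lemma gaussDensity_le (r : ℝ≥0) (θ x : Fin n → ℝ) :
    gaussDensity r θ x ≤ (√(2 * Real.pi * r))⁻¹ ^ n := by
  have h : ∀ i ∈ Finset.univ, gaussianPDFReal (θ i) r (x i) ≤ (√(2 * Real.pi * r))⁻¹ := by
    intro i _
    rw [gaussianPDFReal]
    refine mul_le_of_le_one_right (by positivity) (Real.exp_le_one_iff.2 ?_)
    rw [neg_div]
    exact neg_nonpos.2 (by positivity)
  simpa [gaussDensity] using
    Finset.prod_le_prod (fun i _ => gaussianPDFReal_nonneg (θ i) r (x i)) h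

lemma measurable_gaussDensity (r : ℝ≥0) :
    Measurable fun z : (Fin n → ℝ) × (Fin n → ℝ) => gaussDensity r z.1 z.2 := by
  unfold gaussDensity
  refine Finset.measurable_prod _ fun i _ => ?_
  exact measurable_uncurry_gaussianPDFReal.comp
    (by fun_prop : Measurable fun z : (Fin n → ℝ) × (Fin n → ℝ) => (z.1 i, r, z.2 i))

@[fun_prop]
lemma measurable_gaussDensity_comp {α : Type*} [MeasurableSpace α] (r : ℝ≥0)
    {f g : α → Fin n → ℝ} (hf : Measurable f) (hg : Measurable g) :
    Measurable fun a => gaussDensity r (f a) (g a) := by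
  have h := (measurable_gaussDensity (n := n) r).comp (hf.prodMk hg)
  exact h

lemma integrable_prod_gaussianPDFReal (w : Fin n → ℝ≥0) (θ : Fin n → ℝ) :
    Integrable fun x : Fin n → ℝ => ∏ i, gaussianPDFReal (θ i) (w i) (x i) :=
  Integrable.fintype_prod_dep fun i => integrable_gaussianPDFReal (θ i) (w i)

lemma integral_prod_gaussianPDFReal {w : Fin n → ℝ≥0} (hw : ∀ i, w i ≠ 0) (θ : Fin n → ℝ) :
    ∫ x : Fin n → ℝ, ∏ i, gaussianPDFReal (θ i) (w i) (x i) = 1 := by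
  rw [integral_fintype_prod_volume_eq_prod (fun i x => gaussianPDFReal (θ i) (w i) x)]
  exact Finset.prod_eq_one fun i _ => integral_gaussianPDFReal_eq_one (θ i) (hw i)

lemma lintegral_prod_gaussianPDFReal {w : Fin n → ℝ≥0} (hw : ∀ i, w i ≠ 0) (θ : Fin n → ℝ) :
    ∫⁻ x : Fin n → ℝ, ENNReal.ofReal (∏ i, gaussianPDFReal (θ i) (w i) (x i)) = 1 := by
  rw [← ofReal_integral_eq_lintegral_ofReal (integrable_prod_gaussianPDFReal w θ)
    (ae_of_all _ fun x => Finset.prod_nonneg fun i _ => gaussianPDFReal_nonneg _ _ _),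
    integral_prod_gaussianPDFReal hw, ENNReal.ofReal_one]

lemma lintegral_gaussDensity {r : ℝ≥0} (hr : r ≠ 0) (θ : Fin n → ℝ) :
    ∫⁻ x, ENNReal.ofReal (gaussDensity r θ x) = 1 :=
  lintegral_prod_gaussianPDFReal (fun _ => hr) θ

lemma gaussLaw_eq_withDensity {r : ℝ≥0} (hr : r ≠ 0) (θ : Fin n → ℝ) :
    gaussLaw θ (fun _ => r) = volume.withDensity fun x => ENNReal.ofReal (gaussDensity r θ x) := by
  refine Measure.pi_eq (μ := fun i => gaussianReal (θ i) r) fun s hs => ?_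
  rw [withDensity_apply _ (MeasurableSet.univ_pi hs)]
  have hint : Integrable (fun x => gaussDensity r θ x) :=
    integrable_prod_gaussianPDFReal (fun _ => r) θ
  rw [← ofReal_integral_eq_lintegral_ofReal hint.restrict
    (ae_of_all _ fun x => gaussDensity_nonneg r θ x)]
  have : ∫ x in Set.univ.pi s, gaussDensity r θ x
      = ∏ i, ∫ x in s i, gaussianPDFReal (θ i) r x := by
    rw [volume_pi, Measure.restrict_pi_pi]
    exact integral_fintype_prod_eq_prod fun i x => gaussianPDFReal (θ i) r x
  rw [this, ENNReal.ofReal_prod_of_nonneg fun i _ =>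
    integral_nonneg fun x => gaussianPDFReal_nonneg _ _ _]
  refine Finset.prod_congr rfl fun i _ => ?_
  rw [gaussianReal_apply_eq_integral _ hr]

instance (θ : Fin n → ℝ) (w : Fin n → ℝ≥0) : IsProbabilityMeasure (gaussLaw θ w) := by
  unfold gaussLaw; infer_instance

instance (s : Fin n → ℝ≥0) : IsProbabilityMeasure (gaussPrior s) := by
  unfold gaussPrior; infer_instance

/-- The joint law of the observation, of variance `r`, and of the future observation, of
variance `t`. -/
def obsLaw (r t : ℝ≥0) (θ : Fin n → ℝ) : Measure ((Fin n → ℝ) × (Fin n → ℝ)) :=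
  (gaussLaw θ fun _ => r).prod (gaussLaw θ fun _ => t)

instance (r t : ℝ≥0) (θ : Fin n → ℝ) : IsProbabilityMeasure (obsLaw r t θ) := by
  unfold obsLaw; infer_instance

lemma lintegral_obsLaw {r t : ℝ≥0} (hr : r ≠ 0) (ht : t ≠ 0) (θ : Fin n → ℝ)
    {B : (Fin n → ℝ) × (Fin n → ℝ) → ℝ≥0∞} (hB : Measurable B) :
    ∫⁻ z, B z ∂obsLaw r t θ
      = ∫⁻ x, ∫⁻ y, ENNReal.ofReal (gaussDensity r θ x * gaussDensity t θ y) * B (x, y) := by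
  rw [obsLaw, lintegral_prod _ hB.aemeasurable, gaussLaw_eq_withDensity hr,
    gaussLaw_eq_withDensity ht]
  rw [lintegral_withDensity_eq_lintegral_mul _ (by fun_prop) (Measurable.lintegral_prod_right' hB)]
  refine lintegral_congr fun x => ?_
  simp only [Pi.mul_apply]
  rw [lintegral_withDensity_eq_lintegral_mul _ (by fun_prop) (by fun_prop),
    ← lintegral_const_mul _ (by fun_prop)]
  refine lintegral_congr fun y => ?_
  rw [ENNReal.ofReal_mul (gaussDensity_nonneg _ _ _)]
  simp [mul_assoc]

end GaussDensity

section Mixture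

variable {n : ℕ}

/-- The marginal density of the observation when the mean has the law `π`. -/
def marginalDensity (r : ℝ≥0) (π : Measure (Fin n → ℝ)) (x : Fin n → ℝ) : ℝ :=
  ∫ θ, gaussDensity r θ x ∂π

/-- The joint density of the observation and the future observation when the mean has the
law `π`. -/
def jointDensity (r t : ℝ≥0) (π : Measure (Fin n → ℝ)) (x y : Fin n → ℝ) : ℝ :=
  ∫ θ, gaussDensity r θ x * gaussDensity t θ y ∂π

/-- The Bayes predictive density for the prior `π`. -/
def bayesDensity (r t : ℝ≥0) (π : Measure (Fin n → ℝ)) (x y : Fin n → ℝ) : ℝ :=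
  jointDensity r t π x y / marginalDensity r π x

variable {r t : ℝ≥0} {π : Measure (Fin n → ℝ)} [IsFiniteMeasure π]

lemma integrable_gaussDensity (r : ℝ≥0) (π : Measure (Fin n → ℝ)) [IsFiniteMeasure π]
    (x : Fin n → ℝ) : Integrable (fun θ => gaussDensity r θ x) π := by
  refine Integrable.of_bound (by fun_prop) ((√(2 * Real.pi * r))⁻¹ ^ n) (ae_of_all _ fun θ => ?_)
  rw [Real.norm_of_nonneg (gaussDensity_nonneg _ _ _)]
  exact gaussDensity_le r θ x

lemma integrable_gaussDensity_mul_pow (r t : ℝ≥0) (π : Measure (Fin n → ℝ)) [IsFiniteMeasure π]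
    (x y : Fin n → ℝ) (k : ℕ) :
    Integrable (fun θ => gaussDensity r θ x * gaussDensity t θ y ^ k) π := by
  refine Integrable.of_bound (by fun_prop)
    ((√(2 * Real.pi * r))⁻¹ ^ n * ((√(2 * Real.pi * t))⁻¹ ^ n) ^ k) (ae_of_all _ fun θ => ?_)
  rw [Real.norm_of_nonneg (mul_nonneg (gaussDensity_nonneg _ _ _)
    (pow_nonneg (gaussDensity_nonneg _ _ _) k))]
  exact mul_le_mul (gaussDensity_le r θ x)
    (pow_le_pow_left₀ (gaussDensity_nonneg _ _ _) (gaussDensity_le t θ y) k)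
    (pow_nonneg (gaussDensity_nonneg _ _ _) k) (by positivity)

lemma integrable_gaussDensity_mul (r t : ℝ≥0) (π : Measure (Fin n → ℝ)) [IsFiniteMeasure π]
    (x y : Fin n → ℝ) :
    Integrable (fun θ => gaussDensity r θ x * gaussDensity t θ y) π := by
  simpa using integrable_gaussDensity_mul_pow r t π x y 1

lemma marginalDensity_pos [NeZero π] (hr : r ≠ 0) (x : Fin n → ℝ) :
    0 < marginalDensity r π x := by
  refine (integral_pos_iff_support_of_nonneg (fun θ => gaussDensity_nonneg _ _ _)
    (integrable_gaussDensity r π x)).2 ?_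
  rw [Function.support_eq_univ fun θ => (gaussDensity_pos hr θ x).ne']
  simpa [pos_iff_ne_zero] using NeZero.ne π

lemma jointDensity_pos [NeZero π] (hr : r ≠ 0) (ht : t ≠ 0) (x y : Fin n → ℝ) :
    0 < jointDensity r t π x y := by
  refine (integral_pos_iff_support_of_nonneg
    (fun θ => mul_nonneg (gaussDensity_nonneg _ _ _) (gaussDensity_nonneg _ _ _))
    (integrable_gaussDensity_mul r t π x y)).2 ?_
  rw [Function.support_eq_univ fun θ =>
    (mul_pos (gaussDensity_pos hr θ x) (gaussDensity_pos ht θ y)).ne']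
  simpa [pos_iff_ne_zero] using NeZero.ne π

lemma bayesDensity_pos [NeZero π] (hr : r ≠ 0) (ht : t ≠ 0) (x y : Fin n → ℝ) :
    0 < bayesDensity r t π x y :=
  div_pos (jointDensity_pos hr ht x y) (marginalDensity_pos hr x)

@[fun_prop]
lemma measurable_marginalDensity : Measurable (marginalDensity r π) := by
  have : StronglyMeasurable fun z : (Fin n → ℝ) × (Fin n → ℝ) => gaussDensity r z.2 z.1 :=
    Measurable.stronglyMeasurable (by fun_prop)
  exact this.integral_prod_right'.measurable

lemma measurable_jointDensity :
    Measurable fun z : (Fin n → ℝ) × (Fin n → ℝ) => jointDensity r t π z.1 z.2 := by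
  have : StronglyMeasurable fun z : ((Fin n → ℝ) × (Fin n → ℝ)) × (Fin n → ℝ) =>
      gaussDensity r z.2 z.1.1 * gaussDensity t z.2 z.1.2 :=
    Measurable.stronglyMeasurable (by fun_prop)
  exact this.integral_prod_right'.measurable

@[fun_prop]
lemma measurable_jointDensity_comp {α : Type*} [MeasurableSpace α] {f g : α → Fin n → ℝ}
    (hf : Measurable f) (hg : Measurable g) :
    Measurable fun a => jointDensity r t π (f a) (g a) := by
  have h := (measurable_jointDensity (r := r) (t := t) (π := π)).comp (hf.prodMk hg)
  exact h

@[fun_prop]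
lemma measurable_bayesDensity_comp {α : Type*} [MeasurableSpace α] {f g : α → Fin n → ℝ}
    (hf : Measurable f) (hg : Measurable g) :
    Measurable fun a => bayesDensity r t π (f a) (g a) := by
  unfold bayesDensity
  fun_prop

lemma ofReal_jointDensity (x y : Fin n → ℝ) :
    ENNReal.ofReal (jointDensity r t π x y)
      = ∫⁻ θ, ENNReal.ofReal (gaussDensity r θ x * gaussDensity t θ y) ∂π :=
  ofReal_integral_eq_lintegral_ofReal (integrable_gaussDensity_mul r t π x y)
    (ae_of_all _ fun _ => mul_nonneg (gaussDensity_nonneg _ _ _) (gaussDensity_nonneg _ _ _))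

lemma ofReal_marginalDensity (x : Fin n → ℝ) :
    ENNReal.ofReal (marginalDensity r π x) = ∫⁻ θ, ENNReal.ofReal (gaussDensity r θ x) ∂π :=
  ofReal_integral_eq_lintegral_ofReal (integrable_gaussDensity r π x)
    (ae_of_all _ fun _ => gaussDensity_nonneg _ _ _)

lemma lintegral_marginalDensity (hr : r ≠ 0) :
    ∫⁻ x, ENNReal.ofReal (marginalDensity r π x) = π Set.univ := by
  simp_rw [ofReal_marginalDensity]
  rw [lintegral_lintegral_swap (by fun_prop)]
  simp [lintegral_gaussDensity hr]

lemma lintegral_jointDensity (ht : t ≠ 0) (x : Fin n → ℝ) :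
    ∫⁻ y, ENNReal.ofReal (jointDensity r t π x y) = ENNReal.ofReal (marginalDensity r π x) := by
  simp_rw [ofReal_jointDensity, ofReal_marginalDensity]
  rw [lintegral_lintegral_swap (by fun_prop)]
  refine lintegral_congr fun θ => ?_
  simp_rw [ENNReal.ofReal_mul (gaussDensity_nonneg _ _ _)]
  rw [lintegral_const_mul _ (by fun_prop), lintegral_gaussDensity ht, mul_one]

lemma lintegral_bayesDensity [NeZero π] (hr : r ≠ 0) (ht : t ≠ 0) (x : Fin n → ℝ) :
    ∫⁻ y, ENNReal.ofReal (bayesDensity r t π x y) = 1 := by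
  have hpos := marginalDensity_pos (π := π) hr x
  simp_rw [bayesDensity, ENNReal.ofReal_div_of_pos hpos, div_eq_mul_inv]
  rw [lintegral_mul_const _ (by fun_prop), lintegral_jointDensity ht]
  exact ENNReal.mul_inv_cancel (by simpa using hpos) ENNReal.ofReal_ne_top

lemma lintegral_lintegral_obsLaw (hr : r ≠ 0) (ht : t ≠ 0)
    {B : (Fin n → ℝ) × (Fin n → ℝ) → ℝ≥0∞} (hB : Measurable B) :
    ∫⁻ θ, ∫⁻ z, B z ∂obsLaw r t θ ∂π
      = ∫⁻ x, ∫⁻ y, ENNReal.ofReal (jointDensity r t π x y) * B (x, y) := by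
  simp_rw [lintegral_obsLaw hr ht _ hB, ofReal_jointDensity]
  rw [lintegral_lintegral_swap]
  · refine lintegral_congr fun x => ?_
    rw [lintegral_lintegral_swap (by fun_prop)]
    refine lintegral_congr fun y => ?_
    rw [lintegral_mul_const _ (by fun_prop)]
  · refine Measurable.aemeasurable ?_
    refine Measurable.lintegral_prod_right'
      (f := fun p : ((Fin n → ℝ) × (Fin n → ℝ)) × (Fin n → ℝ) =>
        ENNReal.ofReal (gaussDensity r p.1.1 p.1.2 * gaussDensity t p.1.1 p.2) * B (p.1.2, p.2)) ?_
    fun_prop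

lemma measurable_lintegral_obsLaw (hr : r ≠ 0) (ht : t ≠ 0)
    {B : (Fin n → ℝ) × (Fin n → ℝ) → ℝ≥0∞} (hB : Measurable B) :
    Measurable fun θ => ∫⁻ z, B z ∂obsLaw r t θ := by
  simp_rw [lintegral_obsLaw hr ht _ hB]
  refine Measurable.lintegral_prod_right'
    (f := fun p : (Fin n → ℝ) × (Fin n → ℝ) => ∫⁻ y,
      ENNReal.ofReal (gaussDensity r p.1 p.2 * gaussDensity t p.1 y) * B (p.2, y)) ?_
  refine Measurable.lintegral_prod_right'
    (f := fun p : ((Fin n → ℝ) × (Fin n → ℝ)) × (Fin n → ℝ) =>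
        ENNReal.ofReal (gaussDensity r p.1.1 p.1.2 * gaussDensity t p.1.1 p.2) * B (p.1.2, p.2)) ?_
  fun_prop

end Mixture

/-! ### Extended expectations -/

section ExtExpect

variable {Ω : Type*} [MeasurableSpace Ω] {μ : Measure Ω}

lemma extExpect_mono_ae {g h : Ω → EReal} (hgh : ∀ᵐ ω ∂μ, g ω ≤ h ω) :
    extExpect μ g ≤ extExpect μ h := by
  refine EReal.sub_le_sub ?_ ?_
  · exact EReal.coe_ennreal_le_coe_ennreal_iff.2
      (lintegral_mono_ae (hgh.mono fun ω hω => EReal.toENNReal_le_toENNReal hω))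
  · exact EReal.coe_ennreal_le_coe_ennreal_iff.2
      (lintegral_mono_ae (hgh.mono fun ω hω =>
        EReal.toENNReal_le_toENNReal (EReal.neg_le_neg_iff.2 hω)))

lemma extExpect_coe {f : Ω → ℝ} (hf : Integrable f μ) :
    extExpect μ (fun ω => (f ω : EReal)) = ((∫ ω, f ω ∂μ : ℝ) : EReal) := by
  have h1 : ∫⁻ ω, ENNReal.ofReal (f ω) ∂μ ≠ ∞ := hf.lintegral_lt_top.ne
  have h2 : ∫⁻ ω, ENNReal.ofReal (-f ω) ∂μ ≠ ∞ := hf.neg.lintegral_lt_top.ne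
  rw [integral_eq_lintegral_pos_part_sub_lintegral_neg_part hf, extExpect]
  simp_rw [← EReal.coe_neg, EReal.real_coe_toENNReal]
  rw [EReal.coe_sub, EReal.coe_ennreal_toReal h1, EReal.coe_ennreal_toReal h2]

lemma extExpect_const [IsProbabilityMeasure μ] (c : EReal) :
    extExpect μ (fun _ => c) = c := by
  induction c with
  | bot => simp [extExpect]
  | top => simp [extExpect]
  | coe c => simpa using extExpect_coe (μ := μ) (integrable_const c)

end ExtExpect

lemma log_ofReal_div {p q : ℝ} (hp : 0 < p) (hq : 0 < q) :
    ENNReal.log (ENNReal.ofReal p / ENNReal.ofReal q) = (Real.log (p / q) : EReal) := by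
  rw [← ENNReal.ofReal_div_of_pos hq, ENNReal.log_ofReal_of_pos (div_pos hp hq)]

lemma coe_le_log_ofReal_div {p q h : ℝ} (hp : 0 < p) (hq : 0 ≤ q)
    (hle : 0 < q → h ≤ Real.log (p / q)) :
    (h : EReal) ≤ ENNReal.log (ENNReal.ofReal p / ENNReal.ofReal q) := by
  rcases hq.eq_or_lt with rfl | hq
  · rw [ENNReal.ofReal_zero, ENNReal.div_zero (by simpa using hp), ENNReal.log_top]
    exact le_top
  · rw [log_ofReal_div hp hq]
    exact_mod_cast hle hq

/-! ### Lower bounds for the Bayes risk -/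

section Risk

variable {n : ℕ}

/-- The total Kullback–Leibler risk of the predictive density `q` at `θ`, for an observation of
variance `r` and a future observation of variance `t`. -/
def klRisk (r t : ℝ≥0) (θ : Fin n → ℝ) (q : (Fin n → ℝ) → (Fin n → ℝ) → ℝ) : EReal :=
  extExpect (obsLaw r t θ) fun z =>
    ENNReal.log (ENNReal.ofReal (gaussDensity t θ z.2) / ENNReal.ofReal (q z.1 z.2))

lemma risk_eq_klRisk (m : ℕ) (θ : Fin n → ℝ) (q : (Fin n → ℝ) → (Fin n → ℝ) → ℝ) :
    risk n m θ q = ((1 / (m : ℝ) : ℝ) : EReal) * klRisk (v n) (v m) θ q := rfl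

/-- The predictive density `q` is positive, and its total risk at every `θ` is the convergent
integral `k θ`. -/
structure HasKLRisk (r t : ℝ≥0) (q : (Fin n → ℝ) → (Fin n → ℝ) → ℝ) (k : (Fin n → ℝ) → ℝ) :
    Prop where
  pos : ∀ x y, 0 < q x y
  integrable : ∀ θ, Integrable
    (fun z : (Fin n → ℝ) × (Fin n → ℝ) => Real.log (gaussDensity t θ z.2 / q z.1 z.2))
    (obsLaw r t θ)
  integral_eq : ∀ θ, ∫ z : (Fin n → ℝ) × (Fin n → ℝ),
    Real.log (gaussDensity t θ z.2 / q z.1 z.2) ∂obsLaw r t θ = k θ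

variable {r t : ℝ≥0} {q q₀ : (Fin n → ℝ) → (Fin n → ℝ) → ℝ} {k : (Fin n → ℝ) → ℝ}

lemma HasKLRisk.klRisk_eq (h : HasKLRisk r t q k) (ht : t ≠ 0) (θ : Fin n → ℝ) :
    klRisk r t θ q = (k θ : EReal) := by
  rw [← h.integral_eq θ, ← extExpect_coe (h.integrable θ), klRisk]
  congr 1
  ext z
  exact log_ofReal_div (gaussDensity_pos ht _ _) (h.pos _ _)

/-- Comparison of the average risk of an arbitrary predictive density `q` with that of a reference
density `q₀`: if `log (q / q₀)` is at most `B - c`, then `q` gains at most the average of `B - c`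
over `q₀`. The average of `B` is computed with the joint density of the two observations. -/
lemma le_extExpect_klRisk {π : Measure (Fin n → ℝ)} [IsProbabilityMeasure π]
    (hr : r ≠ 0) (ht : t ≠ 0) (hq : ∀ x y, 0 ≤ q x y) (h₀ : HasKLRisk r t q₀ k)
    (hk : Integrable k π) {B : (Fin n → ℝ) × (Fin n → ℝ) → ℝ} (hB : Measurable B)
    (hB0 : ∀ z, 0 ≤ B z) {c β a : ℝ} (ha : 0 ≤ a) (hβ : 0 ≤ β)
    (hlog : ∀ x y, 0 < q x y → Real.log (q x y / q₀ x y) ≤ B (x, y) - c)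
    (hint : ∫⁻ x, ∫⁻ y, ENNReal.ofReal (jointDensity r t π x y) * ENNReal.ofReal (B (x, y))
      ≤ ENNReal.ofReal β) :
    ((a * (∫ θ, k θ ∂π - β + c) : ℝ) : EReal)
      ≤ extExpect π fun θ => (a : EReal) * klRisk r t θ q := by
  have hBm : Measurable fun z => ENNReal.ofReal (B z) := by fun_prop
  have hbm := measurable_lintegral_obsLaw hr ht hBm
  rw [← lintegral_lintegral_obsLaw hr ht hBm] at hint
  have hfin : ∫⁻ θ, ∫⁻ z, ENNReal.ofReal (B z) ∂obsLaw r t θ ∂π ≠ ∞ :=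
    (hint.trans_lt ENNReal.ofReal_lt_top).ne
  set b : (Fin n → ℝ) → ℝ := fun θ => (∫⁻ z, ENNReal.ofReal (B z) ∂obsLaw r t θ).toReal with hb
  have hae := ae_lt_top hbm hfin
  have hbint : Integrable b π := integrable_toReal_of_lintegral_ne_top hbm.aemeasurable hfin
  have hbβ : ∫ θ, b θ ∂π ≤ β := by
    rw [hb, integral_toReal hbm.aemeasurable hae]
    exact ENNReal.toReal_le_of_le_ofReal hβ hint
  have hle : ∀ᵐ θ ∂π, ((a * (k θ - b θ + c) : ℝ) : EReal) ≤ (a : EReal) * klRisk r t θ q := by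
    filter_upwards [hae] with θ hθ
    rw [EReal.coe_mul]
    refine mul_le_mul_of_nonneg_left ?_ (by exact_mod_cast ha)
    have hBi : Integrable B (obsLaw r t θ) := by
      refine ⟨hB.aestronglyMeasurable, ?_⟩
      rw [hasFiniteIntegral_iff_ofReal (ae_of_all _ hB0)]
      exact hθ
    have hBeq : ∫ z, B z ∂obsLaw r t θ = b θ :=
      integral_eq_lintegral_of_nonneg_ae (ae_of_all _ hB0) hB.aestronglyMeasurable
    have hI₁ : Integrable (fun z : (Fin n → ℝ) × (Fin n → ℝ) =>
        Real.log (gaussDensity t θ z.2 / q₀ z.1 z.2) - B z) (obsLaw r t θ) :=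
      (h₀.integrable θ).sub hBi
    have hI : Integrable (fun z : (Fin n → ℝ) × (Fin n → ℝ) =>
        Real.log (gaussDensity t θ z.2 / q₀ z.1 z.2) - B z + c) (obsLaw r t θ) :=
      hI₁.add (integrable_const c)
    have hval : ∫ z : (Fin n → ℝ) × (Fin n → ℝ),
        (Real.log (gaussDensity t θ z.2 / q₀ z.1 z.2) - B z + c) ∂obsLaw r t θ
          = k θ - b θ + c := by
      rw [integral_add hI₁ (integrable_const c),
        integral_sub (h₀.integrable θ) hBi, h₀.integral_eq, hBeq]
      simp
    rw [← hval, ← extExpect_coe hI]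
    refine extExpect_mono_ae (ae_of_all _ fun z => ?_)
    have hp := gaussDensity_pos ht θ z.2
    refine coe_le_log_ofReal_div hp (hq _ _) fun hqz => ?_
    have h1 := hlog z.1 z.2 hqz
    have h0 := h₀.pos z.1 z.2
    rw [Real.log_div hqz.ne' h0.ne'] at h1
    rw [Real.log_div hp.ne' h0.ne', Real.log_div hp.ne' hqz.ne']
    linarith
  refine le_trans ?_ (extExpect_mono_ae hle)
  have hI₁ : Integrable (fun θ => k θ - b θ) π := hk.sub hbint
  have hI : Integrable (fun θ => a * (k θ - b θ + c)) π :=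
    (hI₁.add (integrable_const c)).const_mul a
  rw [extExpect_coe hI, integral_const_mul]
  have : ∫ θ, (k θ - b θ + c) ∂π = ∫ θ, k θ ∂π - ∫ θ, b θ ∂π + c := by
    rw [integral_add hI₁ (integrable_const c), integral_sub hk hbint]
    simp
  simp only [this]
  refine EReal.coe_le_coe_iff.2 (mul_le_mul_of_nonneg_left ?_ ha)
  linarith

end Risk

/-! ### Gaussian moments -/

lemma integrable_pow_gaussianReal (μ : ℝ) (s : ℝ≥0) (k : ℕ) :
    Integrable (fun x => x ^ k) (gaussianReal μ s) := by
  simpa using (memLp_id_gaussianReal (μ := μ) (v := s) k).integrable_norm_pow'.mono'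
    (by fun_prop) (ae_of_all _ fun x => by simp)

lemma integral_sub_gaussianReal (μ : ℝ) (s : ℝ≥0) :
    ∫ x, (x - μ) ∂gaussianReal μ s = 0 := by
  have h : Integrable (fun x : ℝ => x) (gaussianReal μ s) := by
    simpa using integrable_pow_gaussianReal μ s 1
  rw [integral_sub h (integrable_const μ), integral_id_gaussianReal]
  simp

lemma integral_sub_sq_gaussianReal (μ : ℝ) (s : ℝ≥0) :
    ∫ x, (x - μ) ^ 2 ∂gaussianReal μ s = s := by
  have h := variance_eq_integral (X := fun x : ℝ => x) (μ := gaussianReal μ s) (by fun_prop)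
  rw [variance_fun_id_gaussianReal, integral_id_gaussianReal] at h
  exact h.symm

lemma integrable_sub_gaussianReal (μ : ℝ) (s : ℝ≥0) :
    Integrable (fun x => x - μ) (gaussianReal μ s) := by
  have h : Integrable (fun x : ℝ => x) (gaussianReal μ s) := by
    simpa using integrable_pow_gaussianReal μ s 1
  exact h.sub (integrable_const μ)

lemma integrable_sub_sq_gaussianReal (μ : ℝ) (s : ℝ≥0) :
    Integrable (fun x => (x - μ) ^ 2) (gaussianReal μ s) := by
  have h := ((integrable_pow_gaussianReal μ s 2).sub
    ((integrable_pow_gaussianReal μ s 1).const_mul (2 * μ))).add (integrable_const (μ ^ 2))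
  refine h.congr (ae_of_all _ fun x => ?_)
  simp only [Pi.add_apply, Pi.sub_apply]
  ring

lemma integral_sq_gaussianReal (s : ℝ≥0) : ∫ x, x ^ 2 ∂gaussianReal 0 s = s := by
  simpa using integral_sub_sq_gaussianReal 0 s

lemma integral_pow_four_gaussianReal (s : ℝ≥0) :
    ∫ x, x ^ 4 ∂gaussianReal 0 s = 3 * (s : ℝ) ^ 2 := by
  have h := iteratedDeriv_mgf_zero (X := fun x : ℝ => x) (μ := gaussianReal 0 s)
    (by rw [integrableExpSet_fun_id_gaussianReal]; simp) 4
  have hm : mgf (fun x : ℝ => x) (gaussianReal 0 s) = fun t => Real.exp (s * t ^ 2 / 2) := by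
    rw [mgf_fun_id_gaussianReal]; simp
  have he : ∀ x : ℝ, HasDerivAt (fun t : ℝ => Real.exp (s * t ^ 2 / 2))
      (s * x * Real.exp (s * x ^ 2 / 2)) x := by
    intro x
    convert! ((((hasDerivAt_id x).pow 2).const_mul (s : ℝ)).div_const 2).exp using 1
    simp; ring
  -- The derivative of a polynomial times `exp (s t ^ 2 / 2)`.
  have hp : ∀ p p' : ℝ → ℝ, (∀ x, HasDerivAt p (p' x) x) →
      deriv (fun t => p t * Real.exp (s * t ^ 2 / 2))
        = fun t => (p' t + s * t * p t) * Real.exp (s * t ^ 2 / 2) := by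
    intro p p' h
    funext x
    have hx : HasDerivAt (fun t => p t * Real.exp (s * t ^ 2 / 2)) _ x := (h x).mul (he x)
    rw [hx.deriv]
    ring
  have d1 : deriv (fun t : ℝ => Real.exp (s * t ^ 2 / 2))
      = fun t => (s * t) * Real.exp (s * t ^ 2 / 2) := funext fun x => (he x).deriv
  have d2 := hp (fun t => s * t) (fun _ => s)
    (fun x => by simpa using (hasDerivAt_id x).const_mul (s : ℝ))
  have d3 := hp (fun t => s + s * t * (s * t)) (fun t => 2 * s ^ 2 * t)
    (fun x => by
      have := ((hasDerivAt_pow 2 x).const_mul ((s : ℝ) ^ 2)).const_add (s : ℝ)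
      convert! this using 1
      · funext t; ring
      · simp; ring)
  have d4 := hp (fun t => 2 * s ^ 2 * t + s * t * (s + s * t * (s * t)))
    (fun t => 3 * s ^ 2 + 3 * s ^ 3 * t ^ 2)
    (fun x => by
      have := ((hasDerivAt_id x).const_mul (3 * (s : ℝ) ^ 2)).add
        ((hasDerivAt_pow 3 x).const_mul ((s : ℝ) ^ 3))
      convert! this using 1
      · funext t; simp; ring
      · simp; ring)
  have h4 : iteratedDeriv 4 (fun t : ℝ => Real.exp (s * t ^ 2 / 2)) 0 = 3 * (s : ℝ) ^ 2 := by
    rw [iteratedDeriv_succ, iteratedDeriv_succ, iteratedDeriv_succ, iteratedDeriv_one, d1, d2, d3,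
      d4]
    simp
  rw [hm, h4] at h
  rw [h]
  rfl

/-! ### The risk of the linear densities -/

/-- The coefficient of `θ ^ 2` in twice the risk, in one coordinate, of the linear density with
prior variance `s`. -/
def slope (r t s : ℝ≥0) : ℝ := r ^ 2 / ((s + r) * (t * (s + r) + s * r))

/-- The expectation of a quadratic polynomial in two independent normal variables with the common
mean `θ`. -/
lemma integrable_quadratic_prod (θ : ℝ) (r t : ℝ≥0) (a b c d e f : ℝ) :
    Integrable (fun z : ℝ × ℝ => a + b * (z.2 - θ) ^ 2 + c * (z.1 - θ) ^ 2
      + d * ((z.1 - θ) * (z.2 - θ)) + e * (z.2 - θ) + f * (z.1 - θ))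
      ((gaussianReal θ r).prod (gaussianReal θ t)) ∧
    ∫ z : ℝ × ℝ, (a + b * (z.2 - θ) ^ 2 + c * (z.1 - θ) ^ 2
      + d * ((z.1 - θ) * (z.2 - θ)) + e * (z.2 - θ) + f * (z.1 - θ))
      ∂((gaussianReal θ r).prod (gaussianReal θ t)) = a + b * t + c * r := by
  set P := (gaussianReal θ r).prod (gaussianReal θ t)
  have i1 : Integrable (fun z : ℝ × ℝ => b * (z.2 - θ) ^ 2) P :=
    ((integrable_sub_sq_gaussianReal θ t).comp_snd (gaussianReal θ r)).const_mul b
  have i2 : Integrable (fun z : ℝ × ℝ => c * (z.1 - θ) ^ 2) P :=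
    ((integrable_sub_sq_gaussianReal θ r).comp_fst (gaussianReal θ t)).const_mul c
  have i3 : Integrable (fun z : ℝ × ℝ => d * ((z.1 - θ) * (z.2 - θ))) P :=
    ((integrable_sub_gaussianReal θ r).mul_prod (integrable_sub_gaussianReal θ t)).const_mul d
  have i4 : Integrable (fun z : ℝ × ℝ => e * (z.2 - θ)) P :=
    ((integrable_sub_gaussianReal θ t).comp_snd (gaussianReal θ r)).const_mul e
  have i5 : Integrable (fun z : ℝ × ℝ => f * (z.1 - θ)) P :=
    ((integrable_sub_gaussianReal θ r).comp_fst (gaussianReal θ t)).const_mul f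
  have i0 : Integrable (fun _ : ℝ × ℝ => a) P := integrable_const a
  have s1 : Integrable (fun z : ℝ × ℝ => a + b * (z.2 - θ) ^ 2) P := i0.add i1
  have s2 : Integrable (fun z : ℝ × ℝ => a + b * (z.2 - θ) ^ 2 + c * (z.1 - θ) ^ 2) P :=
    s1.add i2
  have s3 : Integrable (fun z : ℝ × ℝ => a + b * (z.2 - θ) ^ 2 + c * (z.1 - θ) ^ 2
      + d * ((z.1 - θ) * (z.2 - θ))) P := s2.add i3
  have s4 : Integrable (fun z : ℝ × ℝ => a + b * (z.2 - θ) ^ 2 + c * (z.1 - θ) ^ 2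
      + d * ((z.1 - θ) * (z.2 - θ)) + e * (z.2 - θ)) P := s3.add i4
  refine ⟨s4.add i5, ?_⟩
  rw [integral_add s4 i5, integral_add s3 i4, integral_add s2 i3, integral_add s1 i2,
    integral_add i0 i1]
  simp only [integral_const_mul]
  rw [integral_prod_mul (fun x => x - θ) (fun y => y - θ),
    integral_fun_snd (fun y => (y - θ) ^ 2), integral_fun_fst (fun x => (x - θ) ^ 2),
    integral_fun_snd (fun y => y - θ), integral_fun_fst (fun x => x - θ)]
  simp [integral_sub_gaussianReal, integral_sub_sq_gaussianReal]

lemma log_gaussianPDFReal {w : ℝ≥0} (hw : w ≠ 0) (μ x : ℝ) :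
    Real.log (gaussianPDFReal μ w x)
      = -(1 / 2) * Real.log (2 * Real.pi * w) - (x - μ) ^ 2 / (2 * w) := by
  have hw' : (0 : ℝ) < w := by positivity
  have hpi := Real.pi_pos
  rw [gaussianPDFReal, Real.log_mul (by positivity) (by positivity), Real.log_exp, Real.log_inv,
    Real.log_sqrt (by positivity)]
  ring

lemma postVar_add_ne_zero (r s : ℝ≥0) {t : ℝ≥0} (ht : t ≠ 0) : postVar r s + t ≠ 0 := by
  positivity

lemma predPDF_pos (r s : ℝ≥0) {t : ℝ≥0} (ht : t ≠ 0) (x y : ℝ) : 0 < predPDF r t s x y :=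
  gaussianPDFReal_pos _ _ _ (postVar_add_ne_zero r s ht)

/-- The logarithmic loss in one coordinate, expanded around the mean `θ`. -/
lemma log_gaussianPDFReal_div_predPDF (r s : ℝ≥0) {t : ℝ≥0} (ht : t ≠ 0)
    (θ x y : ℝ) :
    Real.log (gaussianPDFReal θ t y / predPDF r t s x y)
      = (1 / 2 * Real.log (1 + infoRatio r t s)
          + (1 - shrink r s) ^ 2 * θ ^ 2 / (2 * (postVar r s + t)))
        + (1 / (2 * (postVar r s + t)) - 1 / (2 * t)) * (y - θ) ^ 2
        + shrink r s ^ 2 / (2 * (postVar r s + t)) * (x - θ) ^ 2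
        + -(2 * shrink r s / (2 * (postVar r s + t))) * ((x - θ) * (y - θ))
        + 2 * (1 - shrink r s) * θ / (2 * (postVar r s + t)) * (y - θ)
        + -(2 * shrink r s * (1 - shrink r s) * θ / (2 * (postVar r s + t))) * (x - θ) := by
  have ht' : (0 : ℝ) < t := by positivity
  have hw : (0 : ℝ) ≤ postVar r s := by positivity
  have hpi := Real.pi_pos
  have hlog : Real.log (2 * Real.pi * ((postVar r s : ℝ) + t))
      = Real.log (2 * Real.pi * t) + Real.log (1 + infoRatio r t s) := by
    rw [← Real.log_mul (by positivity) (by unfold infoRatio; positivity)]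
    congr 1
    unfold infoRatio
    field_simp
    ring
  rw [Real.log_div (gaussianPDFReal_pos _ _ _ ht).ne' (predPDF_pos r s ht x y).ne', predPDF,
    log_gaussianPDFReal ht, log_gaussianPDFReal (postVar_add_ne_zero r s ht)]
  push_cast
  rw [hlog]
  field_simp
  ring

lemma integral_log_predPDF {r t : ℝ≥0} (s : ℝ≥0) (hr : r ≠ 0) (ht : t ≠ 0) (θ : ℝ) :
    Integrable (fun z : ℝ × ℝ => Real.log (gaussianPDFReal θ t z.2 / predPDF r t s z.1 z.2))
      ((gaussianReal θ r).prod (gaussianReal θ t)) ∧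
    ∫ z : ℝ × ℝ, Real.log (gaussianPDFReal θ t z.2 / predPDF r t s z.1 z.2)
      ∂((gaussianReal θ r).prod (gaussianReal θ t))
        = 1 / 2 * (Real.log (1 + infoRatio r t s) + slope r t s * (θ ^ 2 - s)) := by
  have hr' : (0 : ℝ) < r := by positivity
  have ht' : (0 : ℝ) < t := by positivity
  have hs' : (0 : ℝ) ≤ s := by positivity
  simp_rw [log_gaussianPDFReal_div_predPDF r s ht θ]
  obtain ⟨h1, h2⟩ := integrable_quadratic_prod θ r t
    (1 / 2 * Real.log (1 + infoRatio r t s)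
          + (1 - shrink r s) ^ 2 * θ ^ 2 / (2 * (postVar r s + t)))
    (1 / (2 * (postVar r s + t)) - 1 / (2 * t)) (shrink r s ^ 2 / (2 * (postVar r s + t)))
    (-(2 * shrink r s / (2 * (postVar r s + t))))
    (2 * (1 - shrink r s) * θ / (2 * (postVar r s + t)))
    (-(2 * shrink r s * (1 - shrink r s) * θ / (2 * (postVar r s + t))))
  refine ⟨h1, h2.trans ?_⟩
  have hd : (s : ℝ) * r + t * (s + r) ≠ 0 := by positivity
  have hd2 : (s : ℝ) * r / (s + r) + t = (s * r + t * (s + r)) / (s + r) := by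
    field_simp
  simp only [slope, shrink, postVar]
  push_cast
  rw [hd2, add_comm ((t : ℝ) * (s + r)) (s * r)]
  field_simp
  ring

variable {n : ℕ}

lemma marginalDensity_gaussPrior {r : ℝ≥0} (hr : r ≠ 0) (s : Fin n → ℝ≥0) (x : Fin n → ℝ) :
    marginalDensity r (gaussPrior s) x = ∏ i, gaussianPDFReal 0 (s i + r) (x i) := by
  simp only [marginalDensity, gaussPrior, gaussLaw, gaussDensity, Pi.zero_apply]
  rw [integral_fintype_prod_eq_prod (fun i θ => gaussianPDFReal θ r (x i))]
  exact Finset.prod_congr rfl fun i _ => integral_likelihood_gaussianReal _ _ _ hr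

lemma jointDensity_gaussPrior {r t : ℝ≥0} (hr : r ≠ 0) (ht : t ≠ 0) (s : Fin n → ℝ≥0)
    (x y : Fin n → ℝ) :
    jointDensity r t (gaussPrior s) x y
      = marginalDensity r (gaussPrior s) x * ∏ i, predPDF r t (s i) (x i) (y i) := by
  rw [marginalDensity_gaussPrior hr, ← Finset.prod_mul_distrib]
  simp only [jointDensity, gaussPrior, gaussLaw, gaussDensity, Pi.zero_apply,
    ← Finset.prod_mul_distrib]
  rw [integral_fintype_prod_eq_prod
    (fun i θ => gaussianPDFReal θ r (x i) * gaussianPDFReal θ t (y i))]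
  exact Finset.prod_congr rfl fun i _ => integral_joint_gaussianReal _ _ _ hr ht

lemma bayesDensity_gaussPrior {r t : ℝ≥0} (hr : r ≠ 0) (ht : t ≠ 0) (s : Fin n → ℝ≥0)
    (x y : Fin n → ℝ) :
    bayesDensity r t (gaussPrior s) x y = ∏ i, predPDF r t (s i) (x i) (y i) := by
  rw [bayesDensity, jointDensity_gaussPrior hr ht]
  exact mul_div_cancel_left₀ _ (marginalDensity_pos hr x).ne'

lemma isPredictiveDensity_bayesDensity {r t : ℝ≥0} (hr : r ≠ 0) (ht : t ≠ 0)
    (s : Fin n → ℝ≥0) : IsPredictiveDensity (bayesDensity r t (gaussPrior s)) where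
  measurable := by
    have : Measurable fun z : (Fin n → ℝ) × (Fin n → ℝ) =>
      bayesDensity r t (gaussPrior s) z.1 z.2 := by fun_prop
    exact this
  nonneg x y := (bayesDensity_pos hr ht x y).le
  integral_eq_one x := by
    simp_rw [bayesDensity_gaussPrior hr ht]
    exact integral_prod_gaussianPDFReal (fun i => postVar_add_ne_zero r (s i) ht)
      fun i => shrink r (s i) * x i

/-- The total information `∑ log (1 + w_i / t)`, twice the Bayes risk of the prior `N(0, S)`
before the division by `m`. -/
def gaussInfo (r t : ℝ≥0) (s : Fin n → ℝ≥0) : ℝ := ∑ i, Real.log (1 + infoRatio r t (s i))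

lemma hasKLRisk_bayesDensity {r t : ℝ≥0} (hr : r ≠ 0) (ht : t ≠ 0) (s : Fin n → ℝ≥0) :
    HasKLRisk r t (bayesDensity r t (gaussPrior s)) fun θ =>
      1 / 2 * (gaussInfo r t s + ∑ i, slope r t (s i) * (θ i ^ 2 - s i)) := by
  have hlog : ∀ (θ : Fin n → ℝ) (z : (Fin n → ℝ) × (Fin n → ℝ)),
      Real.log (gaussDensity t θ z.2 / bayesDensity r t (gaussPrior s) z.1 z.2)
        = ∑ i, Real.log (gaussianPDFReal (θ i) t (z.2 i) /
            predPDF r t (s i) (z.1 i) (z.2 i)) := by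
    intro θ z
    rw [bayesDensity_gaussPrior hr ht, gaussDensity, ← Finset.prod_div_distrib, Real.log_prod]
    exact fun i _ => (div_pos (gaussianPDFReal_pos _ _ _ ht) (predPDF_pos r (s i) ht _ _)).ne'
  have hmp : ∀ (θ : Fin n → ℝ) (i : Fin n),
      MeasurePreserving (fun z : (Fin n → ℝ) × (Fin n → ℝ) => (z.1 i, z.2 i)) (obsLaw r t θ)
        ((gaussianReal (θ i) r).prod (gaussianReal (θ i) t)) := fun θ i =>
    (measurePreserving_eval (fun i => gaussianReal (θ i) r) i).prod
      (measurePreserving_eval (fun i => gaussianReal (θ i) t) i)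
  have hi : ∀ (θ : Fin n → ℝ) (i : Fin n), Integrable
      (fun z : (Fin n → ℝ) × (Fin n → ℝ) => Real.log (gaussianPDFReal (θ i) t (z.2 i) /
        predPDF r t (s i) (z.1 i) (z.2 i))) (obsLaw r t θ) := fun θ i =>
    (hmp θ i).integrable_comp_of_integrable (integral_log_predPDF (s i) hr ht (θ i)).1
  have hval : ∀ (θ : Fin n → ℝ) (i : Fin n),
      ∫ z : (Fin n → ℝ) × (Fin n → ℝ), Real.log (gaussianPDFReal (θ i) t (z.2 i) /
        predPDF r t (s i) (z.1 i) (z.2 i)) ∂obsLaw r t θ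
      = 1 / 2 * (Real.log (1 + infoRatio r t (s i)) + slope r t (s i) * (θ i ^ 2 - s i)) := by
    intro θ i
    have h := integral_log_predPDF (s i) hr ht (θ i)
    rw [← h.2, ← (hmp θ i).map_eq, integral_map (hmp θ i).measurable.aemeasurable]
    rw [(hmp θ i).map_eq]
    exact h.1.aestronglyMeasurable
  refine ⟨fun x y => bayesDensity_pos hr ht x y, fun θ => ?_, fun θ => ?_⟩
  · simp_rw [hlog]
    exact integrable_finsetSum _ fun i _ => hi θ i
  · simp_rw [hlog]
    rw [integral_finsetSum _ fun i _ => hi θ i]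
    simp_rw [hval]
    rw [← Finset.mul_sum, Finset.sum_add_distrib, gaussInfo]

/-! ### Conditioning a prior on a set of means -/

section Conditioning

variable {n : ℕ} {r t : ℝ≥0}

lemma IsPredictiveDensity.lintegral_eq_one {q : (Fin n → ℝ) → (Fin n → ℝ) → ℝ}
    (hq : IsPredictiveDensity q) (x : Fin n → ℝ) : ∫⁻ y, ENNReal.ofReal (q x y) = 1 := by
  have h := hq.integral_eq_one x
  have hint : Integrable (q x) := by
    by_contra hcon
    rw [integral_undef hcon] at h
    exact zero_ne_one h
  rw [← ofReal_integral_eq_lintegral_ofReal hint (ae_of_all _ (hq.nonneg x)), h,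
    ENNReal.ofReal_one]

lemma measurable_div_bayesDensity {q : (Fin n → ℝ) → (Fin n → ℝ) → ℝ}
    (hq : IsPredictiveDensity q) (π : Measure (Fin n → ℝ)) [IsFiniteMeasure π] :
    Measurable fun z : (Fin n → ℝ) × (Fin n → ℝ) => q z.1 z.2 / bayesDensity r t π z.1 z.2 := by
  have : Measurable fun z : (Fin n → ℝ) × (Fin n → ℝ) => q z.1 z.2 := hq.measurable
  fun_prop

lemma lintegral_joint_mul_div_bayesDensity (hr : r ≠ 0) (ht : t ≠ 0)
    {q : (Fin n → ℝ) → (Fin n → ℝ) → ℝ} (hq : IsPredictiveDensity q)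
    (π : Measure (Fin n → ℝ)) [IsProbabilityMeasure π] :
    ∫⁻ x, ∫⁻ y, ENNReal.ofReal (jointDensity r t π x y) *
      ENNReal.ofReal (q x y / bayesDensity r t π x y) = 1 := by
  have h : ∀ x y, ENNReal.ofReal (jointDensity r t π x y) *
      ENNReal.ofReal (q x y / bayesDensity r t π x y)
        = ENNReal.ofReal (marginalDensity r π x) * ENNReal.ofReal (q x y) := by
    intro x y
    have h1 := jointDensity_pos (π := π) hr ht x y
    have h2 := marginalDensity_pos (π := π) hr x
    rw [← ENNReal.ofReal_mul h1.le, ← ENNReal.ofReal_mul h2.le, bayesDensity]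
    congr 1
    field_simp
  simp_rw [h]
  have h2 : ∀ x, ∫⁻ y, ENNReal.ofReal (marginalDensity r π x) * ENNReal.ofReal (q x y)
      = ENNReal.ofReal (marginalDensity r π x) := by
    intro x
    have : Measurable (q x) := hq.measurable.comp measurable_prodMk_left
    rw [lintegral_const_mul _ (by fun_prop), hq.lintegral_eq_one, mul_one]
  simp_rw [h2]
  rw [lintegral_marginalDensity hr, measure_univ]

/-- No predictive density has a smaller average risk than the Bayes predictive density. -/
lemma integral_le_extExpect_klRisk (hr : r ≠ 0) (ht : t ≠ 0)
    {π : Measure (Fin n → ℝ)} [IsProbabilityMeasure π] {k : (Fin n → ℝ) → ℝ}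
    (hk : HasKLRisk r t (bayesDensity r t π) k) (hki : Integrable k π)
    {q : (Fin n → ℝ) → (Fin n → ℝ) → ℝ} (hq : IsPredictiveDensity q) {a : ℝ} (ha : 0 ≤ a) :
    ((a * ∫ θ, k θ ∂π : ℝ) : EReal) ≤ extExpect π fun θ => (a : EReal) * klRisk r t θ q := by
  have h := le_extExpect_klRisk hr ht hq.nonneg hk hki
    (B := fun z => q z.1 z.2 / bayesDensity r t π z.1 z.2)
    (measurable_div_bayesDensity hq π)
    (fun z => div_nonneg (hq.nonneg _ _) (bayesDensity_pos hr ht _ _).le) (c := 1) (β := 1)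
    ha zero_le_one
    (fun x y hxy => Real.log_le_sub_one_of_pos (div_pos hxy (bayesDensity_pos hr ht _ _)))
    (by rw [lintegral_joint_mul_div_bayesDensity hr ht hq]; simp)
  simpa using h

/-- The second moment of the likelihood of `y` under the unnormalized posterior given `x`. -/
def sqDensity (r t : ℝ≥0) (π : Measure (Fin n → ℝ)) (x y : Fin n → ℝ) : ℝ :=
  ∫ θ, gaussDensity r θ x * gaussDensity t θ y ^ 2 ∂π

lemma marginalDensity_cond (π : Measure (Fin n → ℝ)) (A : Set (Fin n → ℝ)) (x : Fin n → ℝ) :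
    marginalDensity r π[|A] x = (π.real A)⁻¹ * marginalDensity r (π.restrict A) x := by
  simp [marginalDensity, ProbabilityTheory.cond, integral_smul_measure, measureReal_def]

lemma jointDensity_cond (π : Measure (Fin n → ℝ)) (A : Set (Fin n → ℝ)) (x y : Fin n → ℝ) :
    jointDensity r t π[|A] x y = (π.real A)⁻¹ * jointDensity r t (π.restrict A) x y := by
  simp [jointDensity, ProbabilityTheory.cond, integral_smul_measure, measureReal_def]

lemma bayesDensity_cond {π : Measure (Fin n → ℝ)} {A : Set (Fin n → ℝ)}
    (hP : π.real A ≠ 0) (x y : Fin n → ℝ) :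
    bayesDensity r t π[|A] x y = bayesDensity r t (π.restrict A) x y := by
  rw [bayesDensity, jointDensity_cond, marginalDensity_cond,
    mul_div_mul_left _ _ (inv_ne_zero hP), bayesDensity]

variable {π : Measure (Fin n → ℝ)} [IsProbabilityMeasure π] {A : Set (Fin n → ℝ)}

/-- The Cauchy–Schwarz inequality on the set `D`, for the deviation of the likelihood of `y` from
the number `c` under the unnormalized posterior given `x`. -/
lemma sq_joint_restrict_sub_le (x y : Fin n → ℝ) (D : Set (Fin n → ℝ)) (c : ℝ) :
    (jointDensity r t (π.restrict D) x y - c * marginalDensity r (π.restrict D) x) ^ 2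
      ≤ marginalDensity r (π.restrict D) x *
        (sqDensity r t π x y - 2 * c * jointDensity r t π x y
          + c ^ 2 * marginalDensity r π x) := by
  have expand : ∀ (ρ : Measure (Fin n → ℝ)) [IsFiniteMeasure ρ] (e : ℝ),
      Integrable (fun θ => gaussDensity r θ x * (gaussDensity t θ y - e) ^ 2) ρ ∧
      ∫ θ, gaussDensity r θ x * (gaussDensity t θ y - e) ^ 2 ∂ρ
        = sqDensity r t ρ x y - 2 * e * jointDensity r t ρ x y
          + e ^ 2 * marginalDensity r ρ x := by
    intro ρ _ e
    have i1 := integrable_gaussDensity_mul_pow r t ρ x y 2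
    have i2 := (integrable_gaussDensity_mul r t ρ x y).const_mul (2 * e)
    have i3 := (integrable_gaussDensity r ρ x).const_mul (e ^ 2)
    have i12 : Integrable (fun θ => gaussDensity r θ x * gaussDensity t θ y ^ 2
      - 2 * e * (gaussDensity r θ x * gaussDensity t θ y)) ρ := i1.sub i2
    have heq : (fun θ => gaussDensity r θ x * (gaussDensity t θ y - e) ^ 2)
        = fun θ => gaussDensity r θ x * gaussDensity t θ y ^ 2
          - 2 * e * (gaussDensity r θ x * gaussDensity t θ y) + e ^ 2 * gaussDensity r θ x := by
      funext θ; ring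
    rw [heq]
    refine ⟨i12.add i3, ?_⟩
    rw [integral_add i12 i3, integral_sub i1 i2, integral_const_mul, integral_const_mul]
    rfl
  have hnn : ∀ e θ, 0 ≤ gaussDensity r θ x * (gaussDensity t θ y - e) ^ 2 := fun e θ =>
    mul_nonneg (gaussDensity_nonneg _ _ _) (sq_nonneg _)
  have hmono : sqDensity r t (π.restrict D) x y - 2 * c * jointDensity r t (π.restrict D) x y
          + c ^ 2 * marginalDensity r (π.restrict D) x
      ≤ sqDensity r t π x y - 2 * c * jointDensity r t π x y
          + c ^ 2 * marginalDensity r π x := by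
    rw [← (expand (π.restrict D) c).2, ← (expand π c).2]
    exact integral_mono_measure Measure.restrict_le_self (ae_of_all _ (hnn c)) (expand π c).1
  refine le_trans ?_ (mul_le_mul_of_nonneg_left hmono
    (integral_nonneg fun θ => gaussDensity_nonneg _ _ _))
  -- The integral of `p(x) (p(y) - c - e) ^ 2` over `D` is a non-negative quadratic function of `e`.
  have hdisc : ∀ e : ℝ, 0 ≤ marginalDensity r (π.restrict D) x * (e * e)
      + (-2 * (jointDensity r t (π.restrict D) x y - c * marginalDensity r (π.restrict D) x)) * e
      + (sqDensity r t (π.restrict D) x y - 2 * c * jointDensity r t (π.restrict D) x y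
          + c ^ 2 * marginalDensity r (π.restrict D) x) := by
    intro e
    have h : 0 ≤ ∫ θ in D, gaussDensity r θ x * (gaussDensity t θ y - (c + e)) ^ 2 ∂π :=
      integral_nonneg (hnn (c + e))
    rw [(expand (π.restrict D) (c + e)).2] at h
    linarith
  have := discrim_le_zero hdisc
  rw [discrim] at this
  linarith

lemma marginalDensity_restrict_add_compl (hA : MeasurableSet A) (x : Fin n → ℝ) :
    marginalDensity r (π.restrict A) x + marginalDensity r (π.restrict Aᶜ) x
      = marginalDensity r π x :=
  integral_add_compl hA (integrable_gaussDensity r π x)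

lemma jointDensity_restrict_add_compl (hA : MeasurableSet A) (x y : Fin n → ℝ) :
    jointDensity r t (π.restrict A) x y + jointDensity r t (π.restrict Aᶜ) x y
      = jointDensity r t π x y :=
  integral_add_compl hA (integrable_gaussDensity_mul r t π x y)

/-- The pointwise form of the bound for the `χ²` divergence between the Bayes predictive densities
of the restriction of `π` to `A` and of `π`. It vanishes with the mass of `Aᶜ`, because the
difference of the two densities is an integral over `A` and also, up to the sign, over `Aᶜ`. -/
lemma restrict_chiSq_le [NeZero (π.restrict A)] (hr : r ≠ 0) (ht : t ≠ 0) (hA : MeasurableSet A)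
    (x y : Fin n → ℝ) :
    jointDensity r t (π.restrict A) x y *
        (bayesDensity r t (π.restrict A) x y / bayesDensity r t π x y)
      + (marginalDensity r (π.restrict A) x + 2 * marginalDensity r (π.restrict Aᶜ) x)
        * bayesDensity r t π x y
      ≤ 2 * jointDensity r t (π.restrict A) x y
        + 2 * marginalDensity r (π.restrict Aᶜ) x *
          (sqDensity r t π x y / jointDensity r t π x y) := by
  have hα := marginalDensity_pos (π := π.restrict A) hr x
  have hα' : 0 ≤ marginalDensity r (π.restrict Aᶜ) x :=
    integral_nonneg fun θ => gaussDensity_nonneg _ _ _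
  have hG1 := marginalDensity_pos (π := π) hr x
  have hG2 := jointDensity_pos (π := π) hr ht x y
  have hsum := marginalDensity_restrict_add_compl (r := r) (π := π) hA x
  have hjsum := jointDensity_restrict_add_compl (r := r) (t := t) (π := π) hA x y
  have cs1 := sq_joint_restrict_sub_le (r := r) (t := t) (π := π) x y A (bayesDensity r t π x y)
  have cs2 := sq_joint_restrict_sub_le (r := r) (t := t) (π := π) x y Aᶜ (bayesDensity r t π x y)
  unfold bayesDensity at *
  set α := marginalDensity r (π.restrict A) x
  set α' := marginalDensity r (π.restrict Aᶜ) x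
  set β := jointDensity r t (π.restrict A) x y
  set β' := jointDensity r t (π.restrict Aᶜ) x y
  set G1 := marginalDensity r π x
  set G2 := jointDensity r t π x y
  set G3 := sqDensity r t π x y
  have hV : G3 - 2 * (G2 / G1) * G2 + (G2 / G1) ^ 2 * G1 = G3 - G2 ^ 2 / G1 := by
    field_simp; ring
  rw [hV] at cs1 cs2
  have hneg : β' - G2 / G1 * α' = -(β - G2 / G1 * α) := by
    have h1 : G2 / G1 * G1 = G2 := by field_simp
    have h2 : G2 / G1 * α + G2 / G1 * α' = G2 := by rw [← mul_add, hsum, h1]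
    linarith
  rw [hneg, neg_sq] at cs2
  set d := β - G2 / G1 * α
  set V := G3 - G2 ^ 2 / G1
  have hV0 : 0 ≤ V := by
    by_contra hcon
    push Not at hcon
    nlinarith [sq_nonneg d, mul_pos hα (neg_pos.2 hcon)]
  -- Whichever of `A`, `Aᶜ` has the smaller posterior mass gives the bound.
  have key : d ^ 2 * G1 ≤ 2 * α * α' * V := by
    rcases le_total α α' with h | h
    · have h1 : d ^ 2 * G1 ≤ α * V * (2 * α') :=
        mul_le_mul cs1 (by linarith) hG1.le (by positivity)
      linarith
    · have h1 : d ^ 2 * G1 ≤ α' * V * (2 * α) :=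
        mul_le_mul cs2 (by linarith) hG1.le (by positivity)
      linarith
  have e1 : 2 * β + 2 * α' * (G3 / G2) - (β * (β / α / (G2 / G1)) + (α + 2 * α') * (G2 / G1))
      = (2 * α * α' * V - d ^ 2 * G1) / (α * (G2 / G1) * G1) := by
    simp only [d, V]
    field_simp
    ring
  have e2 : 0 ≤ (2 * α * α' * V - d ^ 2 * G1) / (α * (G2 / G1) * G1) :=
    div_nonneg (by linarith) (by positivity)
  linarith

/-- The average over the prior `π.restrict A` of the ratio of the two Bayes predictive densities,
which is one plus a `χ²` divergence, up to the normalization by `π(A)`. The number `K - 1` bounds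
the `χ²` information of `π`. -/
lemma lintegral_restrict_ratio_le [NeZero (π.restrict A)] (hr : r ≠ 0) (ht : t ≠ 0)
    (hA : MeasurableSet A) {K : ℝ} (hK1 : 1 ≤ K)
    (hK : ∀ x, ∫⁻ y, ENNReal.ofReal (sqDensity r t π x y / jointDensity r t π x y)
      ≤ ENNReal.ofReal K) :
    ∫⁻ x, ∫⁻ y, ENNReal.ofReal (jointDensity r t (π.restrict A) x y) *
        ENNReal.ofReal (bayesDensity r t (π.restrict A) x y / bayesDensity r t π x y)
      ≤ π A + ENNReal.ofReal (2 * (K - 1)) * π Aᶜ := by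
  have hx : ∀ x, ∫⁻ y, ENNReal.ofReal (jointDensity r t (π.restrict A) x y) *
        ENNReal.ofReal (bayesDensity r t (π.restrict A) x y / bayesDensity r t π x y)
      ≤ ENNReal.ofReal (marginalDensity r (π.restrict A) x) +
        ENNReal.ofReal (2 * (K - 1)) * ENNReal.ofReal (marginalDensity r (π.restrict Aᶜ) x) := by
    intro x
    have hα := marginalDensity_pos (π := π.restrict A) hr x
    have hα' : 0 ≤ marginalDensity r (π.restrict Aᶜ) x :=
      integral_nonneg fun θ => gaussDensity_nonneg _ _ _
    have hsq : ∀ y, 0 ≤ sqDensity r t π x y / jointDensity r t π x y := fun y =>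
      div_nonneg (integral_nonneg fun θ =>
        mul_nonneg (gaussDensity_nonneg _ _ _) (sq_nonneg _)) (jointDensity_pos hr ht x y).le
    have hle := lintegral_mono (μ := volume) fun y =>
      ENNReal.ofReal_le_ofReal (restrict_chiSq_le (π := π) hr ht hA x y)
    simp_rw [ENNReal.ofReal_add (mul_nonneg (jointDensity_pos (π := π.restrict A) hr ht x _).le
        (div_nonneg (bayesDensity_pos (π := π.restrict A) hr ht x _).le
          (bayesDensity_pos (π := π) hr ht x _).le))
        (mul_nonneg (add_nonneg hα.le (mul_nonneg zero_le_two hα'))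
          (bayesDensity_pos (π := π) hr ht x _).le),
      ENNReal.ofReal_add (mul_nonneg zero_le_two
        (jointDensity_pos (π := π.restrict A) hr ht x _).le)
        (mul_nonneg (mul_nonneg zero_le_two hα') (hsq _)),
      ENNReal.ofReal_mul (add_nonneg hα.le (mul_nonneg zero_le_two hα')),
      ENNReal.ofReal_mul (mul_nonneg zero_le_two hα'), ENNReal.ofReal_mul zero_le_two,
      ENNReal.ofReal_mul (jointDensity_pos (π := π.restrict A) hr ht x _).le] at hle
    rw [lintegral_add_right _ (by fun_prop), lintegral_add_left (by fun_prop),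
      lintegral_const_mul _ (by fun_prop), lintegral_const_mul _ (by fun_prop),
      lintegral_const_mul' _ _ (by finiteness), lintegral_bayesDensity hr ht,
      lintegral_jointDensity ht, mul_one] at hle
    have hle2 := hle.trans (add_le_add_right (mul_le_mul_right (hK x) _) _)
    have hfin : ENNReal.ofReal
        (marginalDensity r (π.restrict A) x + 2 * marginalDensity r (π.restrict Aᶜ) x) ≠ ∞ :=
      ENNReal.ofReal_ne_top
    refine (ENNReal.add_le_add_iff_right hfin).1 (hle2.trans_eq ?_)
    rw [← ENNReal.ofReal_mul zero_le_two, ← ENNReal.ofReal_mul zero_le_two,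
      ← ENNReal.ofReal_mul (by positivity), ← ENNReal.ofReal_mul (by linarith),
      ← ENNReal.ofReal_add (by positivity) (by positivity),
      ← ENNReal.ofReal_add hα.le (mul_nonneg (by linarith) hα'),
      ← ENNReal.ofReal_add (add_nonneg hα.le (mul_nonneg (by linarith) hα')) (by positivity)]
    congr 1
    ring
  refine (lintegral_mono hx).trans_eq ?_
  rw [lintegral_add_left (by fun_prop), lintegral_const_mul _ (by fun_prop),
    lintegral_marginalDensity hr, lintegral_marginalDensity hr]
  simp

lemma lintegral_cond_ratio_le (hr : r ≠ 0) (ht : t ≠ 0)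
    (hA : MeasurableSet A) (hP : 0 < π.real A) {K : ℝ} (hK1 : 1 ≤ K)
    (hK : ∀ x, ∫⁻ y, ENNReal.ofReal (sqDensity r t π x y / jointDensity r t π x y)
      ≤ ENNReal.ofReal K) :
    ∫⁻ x, ∫⁻ y, ENNReal.ofReal (jointDensity r t π[|A] x y) *
        ENNReal.ofReal (bayesDensity r t π[|A] x y / bayesDensity r t π x y)
      ≤ ENNReal.ofReal (1 + 2 * (K - 1) * (1 - π.real A) / π.real A) := by
  have hP0 : π A ≠ 0 := fun h => hP.ne' (by simp [measureReal_def, h])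
  have : NeZero (π.restrict A) := ⟨fun h => hP0 (Measure.restrict_eq_zero.1 h)⟩
  have hPinv : 0 ≤ (π.real A)⁻¹ := (inv_pos.2 hP).le
  have hcompl : 0 ≤ 1 - π.real A := by
    rw [← probReal_compl_eq_one_sub hA]; exact measureReal_nonneg
  have h := lintegral_restrict_ratio_le (π := π) hr ht hA hK1 hK
  simp_rw [jointDensity_cond, bayesDensity_cond hP.ne', ENNReal.ofReal_mul hPinv, mul_assoc]
  simp_rw [lintegral_const_mul' _ _ (ENNReal.ofReal_ne_top (r := (π.real A)⁻¹))]
  refine (mul_le_mul_right h _).trans_eq ?_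
  rw [← ofReal_measureReal (μ := π) (s := A), ← ofReal_measureReal (μ := π) (s := Aᶜ),
    probReal_compl_eq_one_sub hA, ← ENNReal.ofReal_mul (by linarith),
    ← ENNReal.ofReal_add hP.le (mul_nonneg (by linarith) hcompl), ← ENNReal.ofReal_mul hPinv]
  congr 1
  field_simp

/-- The loss of information by conditioning the prior `π` on the event `A`: the Bayes risk of the
conditioned prior is at least its average risk for the Bayes density of `π`, up to the information
that the future observation provides on the event `A`. This is at most `- log π(A)`, and it is also
bounded by a `χ²` divergence, which is small when the future observation is not informative. -/
lemma integral_cond_sub_le_extExpect_klRisk (hr : r ≠ 0) (ht : t ≠ 0)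
    (hA : MeasurableSet A) (hP : 0 < π.real A) {K : ℝ} (hK1 : 1 ≤ K)
    (hK : ∀ x, ∫⁻ y, ENNReal.ofReal (sqDensity r t π x y / jointDensity r t π x y)
      ≤ ENNReal.ofReal K)
    {k : (Fin n → ℝ) → ℝ} (hk : HasKLRisk r t (bayesDensity r t π) k) (hki : Integrable k π[|A])
    {q : (Fin n → ℝ) → (Fin n → ℝ) → ℝ} (hq : IsPredictiveDensity q) {a : ℝ} (ha : 0 ≤ a) :
    ((a * (∫ θ, k θ ∂π[|A] - min (-Real.log (π.real A))
        (2 * (K - 1) * (1 - π.real A) / π.real A)) : ℝ) : EReal)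
      ≤ extExpect π[|A] fun θ => (a : EReal) * klRisk r t θ q := by
  have hP0 : π A ≠ 0 := fun h => hP.ne' (by simp [measureReal_def, h])
  have : NeZero (π.restrict A) := ⟨fun h => hP0 (Measure.restrict_eq_zero.1 h)⟩
  have : IsProbabilityMeasure π[|A] := cond_isProbabilityMeasure hP0
  have hcompl : 0 ≤ 1 - π.real A := by
    rw [← probReal_compl_eq_one_sub hA]; exact measureReal_nonneg
  have hqpos : ∀ x y, 0 < bayesDensity r t π[|A] x y := fun x y => bayesDensity_pos hr ht x y
  have hgpos : ∀ x y, 0 < bayesDensity r t π x y := fun x y => bayesDensity_pos hr ht x y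
  have hm1 : Measurable fun z : (Fin n → ℝ) × (Fin n → ℝ) => q z.1 z.2 := hq.measurable
  have hsplit : ∀ x y, 0 < q x y → Real.log (q x y / bayesDensity r t π x y)
      ≤ (q x y / bayesDensity r t π[|A] x y - 1)
        + Real.log (bayesDensity r t π[|A] x y / bayesDensity r t π x y) := by
    intro x y hxy
    have h1 := Real.log_le_sub_one_of_pos (div_pos hxy (hqpos x y))
    rw [Real.log_div hxy.ne' (hqpos x y).ne'] at h1
    rw [Real.log_div hxy.ne' (hgpos x y).ne', Real.log_div (hqpos x y).ne' (hgpos x y).ne']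
    linarith
  have hI1 := lintegral_joint_mul_div_bayesDensity hr ht hq π[|A]
  have hsum : ∀ R : (Fin n → ℝ) → (Fin n → ℝ) → ℝ,
      (Measurable fun z : (Fin n → ℝ) × (Fin n → ℝ) => R z.1 z.2) → (∀ x y, 0 ≤ R x y) →
      ∀ β, 0 ≤ β →
      ∫⁻ x, ∫⁻ y, ENNReal.ofReal (jointDensity r t π[|A] x y) * ENNReal.ofReal (R x y)
        ≤ ENNReal.ofReal β →
      ∫⁻ x, ∫⁻ y, ENNReal.ofReal (jointDensity r t π[|A] x y) *
        ENNReal.ofReal (q x y / bayesDensity r t π[|A] x y + R x y)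
        ≤ ENNReal.ofReal (1 + β) := by
    intro R hR hR0 β hβ hle
    simp_rw [ENNReal.ofReal_add (div_nonneg (hq.nonneg _ _) (hqpos _ _).le) (hR0 _ _), mul_add]
    have hm2 : Measurable fun z : (Fin n → ℝ) × (Fin n → ℝ) =>
        ENNReal.ofReal (jointDensity r t π[|A] z.1 z.2) *
          ENNReal.ofReal (q z.1 z.2 / bayesDensity r t π[|A] z.1 z.2) := by fun_prop
    have hinner : ∀ x, ∫⁻ y, (ENNReal.ofReal (jointDensity r t π[|A] x y) *
          ENNReal.ofReal (q x y / bayesDensity r t π[|A] x y) +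
          ENNReal.ofReal (jointDensity r t π[|A] x y) * ENNReal.ofReal (R x y))
        = (∫⁻ y, ENNReal.ofReal (jointDensity r t π[|A] x y) *
          ENNReal.ofReal (q x y / bayesDensity r t π[|A] x y)) +
          ∫⁻ y, ENNReal.ofReal (jointDensity r t π[|A] x y) * ENNReal.ofReal (R x y) :=
      fun x => lintegral_add_left (hm2.comp measurable_prodMk_left) _
    simp_rw [hinner]
    rw [lintegral_add_left (Measurable.lintegral_prod_right' hm2), hI1,
      ENNReal.ofReal_add zero_le_one hβ, ENNReal.ofReal_one]
    gcongr
  rcases min_cases (-Real.log (π.real A)) (2 * (K - 1) * (1 - π.real A) / π.real A) with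
    ⟨hmin, -⟩ | ⟨hmin, -⟩
  · have hR0 : ∀ x, 0 < marginalDensity r π x / marginalDensity r π[|A] x := fun x =>
      div_pos (marginalDensity_pos hr x) (marginalDensity_pos hr x)
    have hR : ∫⁻ x, ∫⁻ y, ENNReal.ofReal (jointDensity r t π[|A] x y) *
        ENNReal.ofReal (marginalDensity r π x / marginalDensity r π[|A] x)
          ≤ ENNReal.ofReal 1 := by
      have h1 : ∀ x, ∫⁻ y, ENNReal.ofReal (jointDensity r t π[|A] x y) *
        ENNReal.ofReal (marginalDensity r π x / marginalDensity r π[|A] x)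
          = ENNReal.ofReal (marginalDensity r π x) := by
        intro x
        have hpos := marginalDensity_pos (π := π[|A]) hr x
        rw [lintegral_mul_const _ (by fun_prop), lintegral_jointDensity ht,
          ← ENNReal.ofReal_mul hpos.le, mul_div_cancel₀ _ hpos.ne']
      simp_rw [h1]
      rw [lintegral_marginalDensity hr]
      simp
    have h := le_extExpect_klRisk hr ht hq.nonneg hk hki
      (B := fun z => q z.1 z.2 / bayesDensity r t π[|A] z.1 z.2 +
        marginalDensity r π z.1 / marginalDensity r π[|A] z.1) (by fun_prop)
      (fun z => add_nonneg (div_nonneg (hq.nonneg _ _) (hqpos _ _).le) (hR0 _).le)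
      (c := 2 + Real.log (π.real A)) (β := 1 + 1) ha (by norm_num) ?_
      (hsum (fun x _ => marginalDensity r π x / marginalDensity r π[|A] x) (by fun_prop)
        (fun x _ => (hR0 x).le) 1 zero_le_one hR)
    · rw [hmin]
      convert! h using 3
      ring
    · intro x y hxy
      refine (hsplit x y hxy).trans ?_
      -- The ratio of the joint densities is at most `1 / π(A)`.
      have hj : jointDensity r t π[|A] x y ≤ (π.real A)⁻¹ * jointDensity r t π x y := by
        rw [jointDensity_cond]
        refine mul_le_mul_of_nonneg_left ?_ (inv_pos.2 hP).le
        exact integral_mono_measure Measure.restrict_le_self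
          (ae_of_all _ fun θ => mul_nonneg (gaussDensity_nonneg _ _ _) (gaussDensity_nonneg _ _ _))
          (integrable_gaussDensity_mul r t π x y)
      have hle : bayesDensity r t π[|A] x y / bayesDensity r t π x y
          ≤ (π.real A)⁻¹ * (marginalDensity r π x / marginalDensity r π[|A] x) := by
        have p1 := marginalDensity_pos (π := π[|A]) hr x
        have p2 := marginalDensity_pos (π := π) hr x
        have p3 := jointDensity_pos (π := π) hr ht x y
        rw [div_le_iff₀ (hgpos x y), bayesDensity, bayesDensity, div_le_iff₀ p1]
        refine hj.trans_eq ?_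
        field_simp
      have hlog := Real.log_le_log (div_pos (hqpos x y) (hgpos x y)) hle
      rw [Real.log_mul (inv_pos.2 hP).ne' (hR0 x).ne', Real.log_inv] at hlog
      have := Real.log_le_sub_one_of_pos (hR0 x)
      linarith
  · have hβ : 0 ≤ 1 + 2 * (K - 1) * (1 - π.real A) / π.real A :=
      add_nonneg zero_le_one (div_nonneg (mul_nonneg (by linarith) hcompl) hP.le)
    have hR0 : ∀ x y, 0 < bayesDensity r t π[|A] x y / bayesDensity r t π x y := fun x y =>
      div_pos (hqpos x y) (hgpos x y)
    have h := le_extExpect_klRisk hr ht hq.nonneg hk hki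
      (B := fun z => q z.1 z.2 / bayesDensity r t π[|A] z.1 z.2 +
        bayesDensity r t π[|A] z.1 z.2 / bayesDensity r t π z.1 z.2) (by fun_prop)
      (fun z => add_nonneg (div_nonneg (hq.nonneg _ _) (hqpos _ _).le) (hR0 _ _).le)
      (c := 2) (β := 1 + (1 + 2 * (K - 1) * (1 - π.real A) / π.real A)) ha
      (by linarith) ?_
      (hsum (fun x y => bayesDensity r t π[|A] x y / bayesDensity r t π x y) (by fun_prop)
        (fun x y => (hR0 x y).le) _ hβ (lintegral_cond_ratio_le hr ht hA hP hK1 hK))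
    · rw [hmin]
      convert! h using 3
      ring
    · intro x y hxy
      have := Real.log_le_sub_one_of_pos (hR0 x y)
      have := hsplit x y hxy
      linarith

end Conditioning

/-! ### Conditioned Gaussian priors -/

section GaussPrior

variable {n : ℕ} {r t : ℝ≥0}

lemma infoRatio_nonneg (r t s : ℝ≥0) : 0 ≤ infoRatio r t s := by unfold infoRatio; positivity

lemma gaussInfo_nonneg (r t : ℝ≥0) (s : Fin n → ℝ≥0) : 0 ≤ gaussInfo r t s :=
  Finset.sum_nonneg fun i _ => Real.log_nonneg (by linarith [infoRatio_nonneg r t (s i)])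

/-- The `χ²` information of a Gaussian prior about the future observation does not depend on the
first observation. -/
lemma lintegral_sqDensity_div_gaussPrior (hr : r ≠ 0) (ht : t ≠ 0) (s : Fin n → ℝ≥0)
    (x : Fin n → ℝ) :
    ∫⁻ y, ENNReal.ofReal (sqDensity r t (gaussPrior s) x y / jointDensity r t (gaussPrior s) x y)
      = ENNReal.ofReal (Real.exp (gaussInfo r t s)) := by
  have h : ∀ y, sqDensity r t (gaussPrior s) x y / jointDensity r t (gaussPrior s) x y
      = (∏ i, (1 + infoRatio r t (s i))) * ∏ i, tiltPDF r t (s i) (x i) (y i) := by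
    intro y
    have hsq : sqDensity r t (gaussPrior s) x y = ∏ i, (gaussianPDFReal 0 (s i + r) (x i) *
        ((1 + infoRatio r t (s i)) *
          (tiltPDF r t (s i) (x i) (y i) * predPDF r t (s i) (x i) (y i)))) := by
      simp only [sqDensity, gaussPrior, gaussLaw, gaussDensity, Pi.zero_apply,
        ← Finset.prod_mul_distrib, ← Finset.prod_pow]
      rw [integral_fintype_prod_eq_prod
        (fun i θ => gaussianPDFReal θ r (x i) * gaussianPDFReal θ t (y i) ^ 2)]
      exact Finset.prod_congr rfl fun i _ => integral_joint_sq_gaussianReal _ _ _ hr ht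
    rw [div_eq_iff (jointDensity_pos hr ht x y).ne', hsq, jointDensity_gaussPrior hr ht,
      marginalDensity_gaussPrior hr, ← Finset.prod_mul_distrib, ← Finset.prod_mul_distrib,
      ← Finset.prod_mul_distrib]
    exact Finset.prod_congr rfl fun i _ => by ring
  have hexp : ∏ i, (1 + infoRatio r t (s i)) = Real.exp (gaussInfo r t s) := by
    rw [gaussInfo, Real.exp_sum]
    exact Finset.prod_congr rfl fun i _ =>
      (Real.exp_log (by linarith [infoRatio_nonneg r t (s i)])).symm
  simp_rw [h, hexp, ENNReal.ofReal_mul (Real.exp_pos _).le]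
  have hvar : ∀ i, (postVar r (s i) + t / 2) * (postVar r (s i) + t) / (t / 2) ≠ 0 := fun i => by
    positivity
  rw [lintegral_const_mul' _ _ ENNReal.ofReal_ne_top]
  unfold tiltPDF
  rw [lintegral_prod_gaussianPDFReal hvar fun i => shrink r (s i) * x i, mul_one]

lemma memLp_sq_gaussianReal (s : ℝ≥0) : MemLp (fun x : ℝ => x ^ 2) 2 (gaussianReal 0 s) := by
  rw [memLp_two_iff_integrable_sq (by fun_prop)]
  refine (integrable_pow_gaussianReal 0 s 4).congr (ae_of_all _ fun x => ?_)
  ring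

lemma variance_sq_gaussianReal (s : ℝ≥0) :
    Var[fun x : ℝ => x ^ 2; gaussianReal 0 s] = 2 * (s : ℝ) ^ 2 := by
  rw [variance_eq_sub (memLp_sq_gaussianReal s)]
  have h : ∫ x, ((fun x : ℝ => x ^ 2) ^ 2) x ∂gaussianReal 0 s = 3 * (s : ℝ) ^ 2 := by
    rw [← integral_pow_four_gaussianReal]
    refine integral_congr_ae (ae_of_all _ fun x => ?_)
    simp only [Pi.pow_apply]
    ring
  rw [h, integral_sq_gaussianReal]
  ring

lemma integrable_coord_sq (s : Fin n → ℝ≥0) (i : Fin n) :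
    Integrable (fun θ : Fin n → ℝ => θ i ^ 2) (gaussPrior s) :=
  integrable_comp_eval (μ := fun i => gaussianReal 0 (s i)) (i := i) (f := fun x : ℝ => x ^ 2)
    (integrable_pow_gaussianReal 0 (s i) 2)

lemma integral_coord_sq (s : Fin n → ℝ≥0) (i : Fin n) :
    ∫ θ : Fin n → ℝ, θ i ^ 2 ∂gaussPrior s = s i := by
  rw [← integral_sq_gaussianReal (s i)]
  exact integral_comp_eval (μ := fun i => gaussianReal 0 (s i)) (f := fun x : ℝ => x ^ 2)
    (by fun_prop)

lemma integrable_coord_pow_four (s : Fin n → ℝ≥0) (i : Fin n) :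
    Integrable (fun θ : Fin n → ℝ => θ i ^ 4) (gaussPrior s) :=
  integrable_comp_eval (μ := fun i => gaussianReal 0 (s i)) (i := i) (f := fun x : ℝ => x ^ 4)
    (integrable_pow_gaussianReal 0 (s i) 4)

lemma integral_coord_pow_four (s : Fin n → ℝ≥0) (i : Fin n) :
    ∫ θ : Fin n → ℝ, θ i ^ 4 ∂gaussPrior s = 3 * (s i : ℝ) ^ 2 := by
  rw [← integral_pow_four_gaussianReal (s i)]
  exact integral_comp_eval (μ := fun i => gaussianReal 0 (s i)) (f := fun x : ℝ => x ^ 4)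
    (by fun_prop)

lemma measurableSet_ellipsoid (a : ℕ → ℝ) (C : ℝ) (n : ℕ) : MeasurableSet (ellipsoid a C n) := by
  unfold ellipsoid
  exact measurableSet_le (by fun_prop) (by fun_prop)

/-- Chebyshev's inequality for the mass of a Gaussian prior outside of the ellipsoid. -/
lemma gaussPrior_compl_ellipsoid_le (a : ℕ → ℝ) {C : ℝ} (s : Fin n → ℝ≥0)
    (hC : ∑ i : Fin n, a i ^ 2 * (s i : ℝ) < C) :
    (gaussPrior s).real (ellipsoid a C n)ᶜ
      ≤ 2 * (∑ i : Fin n, a i ^ 4 * (s i : ℝ) ^ 2) /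
        (C - ∑ i : Fin n, a i ^ 2 * (s i : ℝ)) ^ 2 := by
  set X : (Fin n → ℝ) → ℝ := ∑ i : Fin n, fun θ : Fin n → ℝ => a i ^ 2 * θ i ^ 2 with hX
  have hXv : ∀ θ, X θ = ∑ i : Fin n, a i ^ 2 * θ i ^ 2 := fun θ => by simp [hX]
  have hmem : ∀ i : Fin n, MemLp (fun x : ℝ => a i ^ 2 * x ^ 2) 2 (gaussianReal 0 (s i)) :=
    fun i => (memLp_sq_gaussianReal (s i)).const_mul _
  have hvar : Var[X; gaussPrior s] = 2 * ∑ i : Fin n, a i ^ 4 * (s i : ℝ) ^ 2 := by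
    have h := variance_sum_pi hmem
    rw [hX]
    refine h.trans ?_
    rw [Finset.mul_sum]
    refine Finset.sum_congr rfl fun i _ => ?_
    rw [variance_const_mul, variance_sq_gaussianReal]
    ring
  have hmean : ∫ θ, X θ ∂gaussPrior s = ∑ i : Fin n, a i ^ 2 * (s i : ℝ) := by
    simp_rw [hXv]
    rw [integral_finsetSum _ fun i _ => (integrable_coord_sq s i).const_mul _]
    refine Finset.sum_congr rfl fun i _ => ?_
    rw [integral_const_mul, integral_coord_sq]
  have hXmem : MemLp X 2 (gaussPrior s) := by
    rw [hX]
    exact memLp_finsetSum' _ fun i _ =>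
      (hmem i).comp_measurePreserving (measurePreserving_eval (fun i => gaussianReal 0 (s i)) i)
  have hpos : 0 < C - ∑ i : Fin n, a i ^ 2 * (s i : ℝ) := by linarith
  have hcheb := meas_ge_le_variance_div_sq hXmem hpos
  rw [hmean, hvar] at hcheb
  have hsub : (ellipsoid a C n)ᶜ ⊆ {θ | C - ∑ i : Fin n, a i ^ 2 * (s i : ℝ)
      ≤ |X θ - ∑ i : Fin n, a i ^ 2 * (s i : ℝ)|} := by
    intro θ hθ
    simp only [ellipsoid, Set.mem_compl_iff, Set.mem_ofPred_eq, not_le] at hθ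
    rw [Set.mem_ofPred_eq, hXv]
    exact le_trans (by linarith) (le_abs_self _)
  rw [measureReal_def]
  exact ENNReal.toReal_le_of_le_ofReal
    (div_nonneg (mul_nonneg zero_le_two
      (Finset.sum_nonneg fun i _ => mul_nonneg (by positivity) (by positivity)))
      (sq_nonneg _)) ((measure_mono hsub).trans hcheb)

/-- The second moments of a Gaussian prior that is conditioned on a set of large mass. -/
lemma le_integral_cond_coord_sq (s : Fin n → ℝ≥0) {A : Set (Fin n → ℝ)} (hA : MeasurableSet A)
    (hP : 0 < (gaussPrior s).real A) (i : Fin n) {κ : ℝ} (hκ : 0 < κ) :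
    (s i : ℝ) * (1 - 3 * κ / 2 - (1 - (gaussPrior s).real A) / (2 * κ))
      ≤ ∫ θ : Fin n → ℝ, θ i ^ 2 ∂(gaussPrior s)[|A] := by
  have hnn : 0 ≤ ∫ θ in A, θ i ^ 2 ∂gaussPrior s := integral_nonneg fun θ => sq_nonneg _
  have hcond : ∫ θ : Fin n → ℝ, θ i ^ 2 ∂(gaussPrior s)[|A]
      = ((gaussPrior s).real A)⁻¹ * ∫ θ in A, θ i ^ 2 ∂gaussPrior s := by
    simp [ProbabilityTheory.cond, integral_smul_measure, measureReal_def]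
  have hge : ∫ θ in A, θ i ^ 2 ∂gaussPrior s ≤ ∫ θ : Fin n → ℝ, θ i ^ 2 ∂(gaussPrior s)[|A] := by
    rw [hcond]
    exact le_mul_of_one_le_left hnn ((one_le_inv₀ hP).2 measureReal_le_one)
  refine le_trans ?_ hge
  rcases eq_or_ne (s i) 0 with h0 | h0
  · rw [h0]; simpa using hnn
  have hs : (0 : ℝ) < s i := by positivity
  have hsplit := integral_add_compl hA (integrable_coord_sq s i)
  rw [integral_coord_sq] at hsplit
  have hbound : ∫ θ in Aᶜ, θ i ^ 2 ∂gaussPrior s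
      ≤ s i * (3 * κ / 2) + s i * ((1 - (gaussPrior s).real A) / (2 * κ)) := by
    -- The inequality between arithmetic and geometric means replaces the Cauchy–Schwarz inequality.
    have hpt : ∀ θ : Fin n → ℝ, θ i ^ 2 ≤ κ / (2 * s i) * θ i ^ 4 + s i / (2 * κ) := by
      intro θ
      have h : κ / (2 * s i) * θ i ^ 4 + s i / (2 * κ) - θ i ^ 2
          = (κ * θ i ^ 2 - s i) ^ 2 / (2 * κ * s i) := by
        field_simp
        ring
      have h2 : 0 ≤ (κ * θ i ^ 2 - s i) ^ 2 / (2 * κ * s i) := by positivity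
      linarith
    have hi4 := (integrable_coord_pow_four s i).const_mul (κ / (2 * s i))
    calc ∫ θ in Aᶜ, θ i ^ 2 ∂gaussPrior s
        ≤ ∫ θ in Aᶜ, (κ / (2 * s i) * θ i ^ 4 + s i / (2 * κ)) ∂gaussPrior s :=
          integral_mono (integrable_coord_sq s i).restrict
            (hi4.restrict.add (integrable_const _)) hpt
      _ = ∫ θ in Aᶜ, κ / (2 * s i) * θ i ^ 4 ∂gaussPrior s
            + (1 - (gaussPrior s).real A) * (s i / (2 * κ)) := by
          rw [integral_add hi4.restrict (integrable_const _)]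
          simp [probReal_compl_eq_one_sub hA]
      _ ≤ ∫ θ, κ / (2 * s i) * θ i ^ 4 ∂gaussPrior s
            + (1 - (gaussPrior s).real A) * (s i / (2 * κ)) := by
          refine add_le_add (setIntegral_le_integral hi4 (ae_of_all _ fun θ => ?_)) le_rfl
          change (0 : ℝ) ≤ _
          positivity
      _ = s i * (3 * κ / 2) + s i * ((1 - (gaussPrior s).real A) / (2 * κ)) := by
          rw [integral_const_mul, integral_coord_pow_four]
          field_simp
  linarith

lemma slope_nonneg (r t s : ℝ≥0) : 0 ≤ slope r t s := by unfold slope; positivity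

/-- The part of the risk that is proportional to `θ ^ 2` is at most the Bayes risk, so that a small
relative loss of the second moments of a prior is a small relative loss of risk. -/
lemma slope_mul_le_log (hr : r ≠ 0) (ht : t ≠ 0) (s : ℝ≥0) :
    slope r t s * s ≤ Real.log (1 + infoRatio r t s) := by
  have hr' : (0 : ℝ) < r := by positivity
  have ht' : (0 : ℝ) < t := by positivity
  have hs' : (0 : ℝ) ≤ s := by positivity
  have hpos : 0 < 1 + infoRatio r t s := by linarith [infoRatio_nonneg r t s]
  refine le_trans ?_ (Real.one_sub_inv_le_log_of_pos hpos)
  have h1 : 1 - (1 + infoRatio r t s)⁻¹ = s * r / (t * (s + r) + s * r) := by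
    have hd : (t : ℝ) * (s + r) + s * r ≠ 0 := by positivity
    have : 1 + infoRatio r t s = (t * (s + r) + s * r) / (t * (s + r)) := by
      simp only [infoRatio, postVar]; push_cast; field_simp
    rw [this, inv_div, eq_div_iff hd, sub_mul, div_mul_cancel₀ _ hd]
    ring
  have h2 : slope r t s * s = s * r / (t * (s + r) + s * r) * (r / (s + r)) := by
    unfold slope
    have hd : (t : ℝ) * (s + r) + s * r ≠ 0 := by positivity
    field_simp
  rw [h1, h2]
  refine mul_le_of_le_one_right (by positivity) ?_
  rw [div_le_one (by positivity)]
  linarith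

/-- Shrinking the prior variances by a factor shrinks the information at most by that factor. -/
lemma mul_gaussInfo_le (hr : r ≠ 0) {c : ℝ≥0} (hc : c ≤ 1) (s : Fin n → ℝ≥0) :
    c * gaussInfo r t s ≤ gaussInfo r t fun i => c * s i := by
  rw [gaussInfo, Finset.mul_sum]
  refine Finset.sum_le_sum fun i _ => ?_
  have hr' : (0 : ℝ) < r := by positivity
  have hc' : (c : ℝ) ≤ 1 := by exact_mod_cast hc
  have hs' : (0 : ℝ) ≤ s i := by positivity
  have hρ := infoRatio_nonneg r t (s i)
  have hle : c * infoRatio r t (s i) ≤ infoRatio r t (c * s i) := by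
    simp only [infoRatio, postVar]
    push_cast
    rw [← mul_div_assoc]
    gcongr
    rw [← mul_div_assoc, mul_assoc]
    gcongr
    exact mul_le_of_le_one_left hs' hc'
  have hpow : (1 + infoRatio r t (s i)) ^ (c : ℝ) ≤ 1 + c * infoRatio r t (s i) :=
    rpow_one_add_le_one_add_mul_self (by linarith) (by positivity) hc'
  rw [← Real.log_rpow (by linarith)]
  exact Real.log_le_log (Real.rpow_pos_of_pos (by linarith) _) (hpow.trans (by linarith))

/-- For a prior with the information `z`, the first bound for the cost of conditioning on an event
of probability `P` is better for large `z`, the second for small `z`. -/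
lemma min_information_le {P z : ℝ} (hP : 1 / 2 ≤ P) (hP1 : P ≤ 1) (hz : 0 ≤ z) :
    min (-Real.log P) (2 * (Real.exp z - 1) * (1 - P) / P) ≤ 8 * (1 - P) * z := by
  have hP0 : 0 < P := by linarith
  rcases le_total 1 z with h | h
  · refine (min_le_left _ _).trans ?_
    have h1 := Real.one_sub_inv_le_log_of_pos hP0
    have h2 : P⁻¹ - 1 ≤ 2 * (1 - P) := by
      rw [inv_eq_one_div, div_sub_one hP0.ne', div_le_iff₀ hP0]
      nlinarith
    nlinarith
  · refine (min_le_right _ _).trans ?_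
    have h1 : Real.exp z - 1 ≤ 2 * z := by
      have := Real.abs_exp_sub_one_sub_id_le (x := z) (by rwa [abs_of_nonneg hz])
      have := le_abs_self (Real.exp z - 1 - z)
      nlinarith
    rw [div_le_iff₀ hP0]
    have h3 : 0 ≤ (1 - P) * z := mul_nonneg (by linarith) hz
    have h4 : (Real.exp z - 1) * (1 - P) ≤ 2 * z * (1 - P) :=
      mul_le_mul_of_nonneg_right h1 (by linarith)
    nlinarith

/-- The Bayes risk of a Gaussian prior that is conditioned on a set `A` of large mass is close to
that of the Gaussian prior itself. The relative error depends only on the mass of `A`. -/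
lemma gaussInfo_mul_le_extExpect_cond (hr : r ≠ 0) (ht : t ≠ 0) (s : Fin n → ℝ≥0)
    {A : Set (Fin n → ℝ)} (hA : MeasurableSet A) {ε κ : ℝ}
    (hε : 1 - (gaussPrior s).real A ≤ ε) (hε2 : ε ≤ 1 / 2) (hκ : 0 < κ)
    {q : (Fin n → ℝ) → (Fin n → ℝ) → ℝ} (hq : IsPredictiveDensity q) {a : ℝ} (ha : 0 ≤ a) :
    ((a * (1 / 2 * gaussInfo r t s * (1 - 3 * κ / 2 - ε / (2 * κ) - 16 * ε)) : ℝ) : EReal)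
      ≤ extExpect (gaussPrior s)[|A] fun θ => (a : EReal) * klRisk r t θ q := by
  set P := (gaussPrior s).real A with hPdef
  have hP : 1 / 2 ≤ P := by linarith
  have hP0 : 0 < P := by linarith
  have hP1 : P ≤ 1 := measureReal_le_one
  have hP' : gaussPrior s A ≠ 0 := fun h => hP0.ne' (by simp [hPdef, measureReal_def, h])
  have : IsProbabilityMeasure (gaussPrior s)[|A] := cond_isProbabilityMeasure hP'
  have hz := gaussInfo_nonneg r t s
  have hiA : ∀ i, Integrable (fun θ : Fin n → ℝ => θ i ^ 2) (gaussPrior s)[|A] := fun i => by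
    rw [ProbabilityTheory.cond]
    exact (integrable_coord_sq s i).restrict.smul_measure (ENNReal.inv_ne_top.2 hP')
  have hterm : ∀ i, Integrable (fun θ : Fin n → ℝ => slope r t (s i) * (θ i ^ 2 - s i))
      (gaussPrior s)[|A] := fun i => ((hiA i).sub (integrable_const _)).const_mul _
  have hsumi : Integrable (fun θ : Fin n → ℝ => ∑ i, slope r t (s i) * (θ i ^ 2 - s i))
      (gaussPrior s)[|A] := integrable_finsetSum _ fun i _ => hterm i
  have hki : Integrable (fun θ : Fin n → ℝ =>
      1 / 2 * (gaussInfo r t s + ∑ i, slope r t (s i) * (θ i ^ 2 - s i))) (gaussPrior s)[|A] :=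
    ((integrable_const _).add hsumi).const_mul _
  have hlow := integral_cond_sub_le_extExpect_klRisk hr ht hA hP0 (Real.one_le_exp hz)
    (fun x => (lintegral_sqDensity_div_gaussPrior hr ht s x).le)
    (hasKLRisk_bayesDensity hr ht s) hki hq ha
  refine le_trans (EReal.coe_le_coe_iff.2 (mul_le_mul_of_nonneg_left ?_ ha)) hlow
  rw [← hPdef]
  have hmin := min_information_le hP hP1 hz
  have hmean : -(gaussInfo r t s * (3 * κ / 2 + ε / (2 * κ)))
      ≤ ∫ θ : Fin n → ℝ, ∑ i, slope r t (s i) * (θ i ^ 2 - s i) ∂(gaussPrior s)[|A] := by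
    rw [integral_finsetSum _ fun i _ => hterm i, gaussInfo, Finset.sum_mul,
      ← Finset.sum_neg_distrib]
    refine Finset.sum_le_sum fun i _ => ?_
    rw [integral_const_mul, integral_sub (hiA i) (integrable_const _)]
    simp only [integral_const, probReal_univ, one_smul]
    have h1 := le_integral_cond_coord_sq s hA hP0 i hκ
    have h2 := slope_mul_le_log hr ht (s i)
    have h3 := slope_nonneg r t (s i)
    have h4 : (1 - P) / (2 * κ) ≤ ε / (2 * κ) := by gcongr
    have h5 : 0 ≤ 3 * κ / 2 + ε / (2 * κ) := by
      have : 0 ≤ ε / (2 * κ) := div_nonneg (by linarith) (by linarith)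
      linarith
    have hs' : (0 : ℝ) ≤ s i := by positivity
    have h6 : -((s i : ℝ) * (3 * κ / 2 + ε / (2 * κ)))
        ≤ ∫ θ : Fin n → ℝ, θ i ^ 2 ∂(gaussPrior s)[|A] - s i := by
      have := mul_le_mul_of_nonneg_left h4 hs'
      linarith
    have h7 := mul_le_mul_of_nonneg_left h6 h3
    have h8 := mul_le_mul_of_nonneg_right h2 h5
    linarith
  have hval : ∫ θ : Fin n → ℝ, 1 / 2 * (gaussInfo r t s +
      ∑ i, slope r t (s i) * (θ i ^ 2 - s i)) ∂(gaussPrior s)[|A]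
        = 1 / 2 * (gaussInfo r t s +
          ∫ θ : Fin n → ℝ, ∑ i, slope r t (s i) * (θ i ^ 2 - s i) ∂(gaussPrior s)[|A]) := by
    rw [integral_const_mul, integral_add (integrable_const _) hsumi]
    simp
  rw [hval]
  have h9 : (1 - P) * gaussInfo r t s ≤ ε * gaussInfo r t s := mul_le_mul_of_nonneg_right hε hz
  linarith

/-- The Bayes risk of a Gaussian prior. -/
lemma integral_risk_gaussPrior (s : Fin n → ℝ≥0) :
    Integrable (fun θ : Fin n → ℝ =>
      1 / 2 * (gaussInfo r t s + ∑ i, slope r t (s i) * (θ i ^ 2 - s i))) (gaussPrior s) ∧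
    ∫ θ : Fin n → ℝ, 1 / 2 * (gaussInfo r t s +
      ∑ i, slope r t (s i) * (θ i ^ 2 - s i)) ∂gaussPrior s = 1 / 2 * gaussInfo r t s := by
  have hterm : ∀ i, Integrable (fun θ : Fin n → ℝ => slope r t (s i) * (θ i ^ 2 - s i))
      (gaussPrior s) := fun i => ((integrable_coord_sq s i).sub (integrable_const _)).const_mul _
  have hsumi : Integrable (fun θ : Fin n → ℝ => ∑ i, slope r t (s i) * (θ i ^ 2 - s i))
      (gaussPrior s) := integrable_finsetSum _ fun i _ => hterm i
  refine ⟨((integrable_const _).add hsumi).const_mul _, ?_⟩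
  rw [integral_const_mul, integral_add (integrable_const _) hsumi,
    integral_finsetSum _ fun i _ => hterm i]
  have h0 : ∀ i, ∫ θ : Fin n → ℝ, slope r t (s i) * (θ i ^ 2 - s i) ∂gaussPrior s = 0 := by
    intro i
    rw [integral_const_mul, integral_sub (integrable_coord_sq s i) (integrable_const _),
      integral_coord_sq]
    simp
  simp [h0]

end GaussPrior

/-! ### The least favorable Gaussian prior -/

section LeastFavorable

variable {a : ℕ → ℝ} {C : ℝ} {n m : ℕ} {l : ℝ}

lemma coe_v (k : ℕ) : (v k : ℝ) = 1 / k := by simp [v]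

lemma v_ne_zero {k : ℕ} (hk : 1 ≤ k) : v k ≠ 0 := by
  have : (k : ℝ≥0) ≠ 0 := by exact_mod_cast (by omega : k ≠ 0)
  unfold v
  positivity

lemma v_add_lt (hn : 1 ≤ n) (hm : 1 ≤ m) : (v (n + m) : ℝ) < v n := by
  rw [coe_v, coe_v]
  have : (0 : ℝ) < n := by exact_mod_cast hn
  have : (0 : ℝ) < m := by exact_mod_cast hm
  push_cast
  exact one_div_lt_one_div_of_lt (by positivity) (by linarith)

lemma slope_v (hn : 1 ≤ n) (hm : 1 ≤ m) (s : ℝ≥0) :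
    slope (v n) (v m) s = ((v n : ℝ) - v (n + m)) / ((s + v n) * (s + v (n + m))) := by
  have hn' : (0 : ℝ) < n := by exact_mod_cast hn
  have hm' : (0 : ℝ) < m := by exact_mod_cast hm
  have hs' : (0 : ℝ) ≤ s := by positivity
  have h1 : (s : ℝ) * (n + m) + 1 ≠ 0 := by positivity
  unfold slope
  simp only [coe_v]
  push_cast
  field_simp
  ring

lemma bracket_nonneg (n m : ℕ) (l b : ℝ) : 0 ≤ bracket n m l b := le_max_right _ _

lemma coe_thetaSq (a : ℕ → ℝ) (n m : ℕ) (l : ℝ) (i : Fin n) :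
    (thetaSq a n m l i : ℝ) = 1 / 2 * bracket n m l (a i) :=
  Real.coe_toNNReal _ (mul_nonneg (by norm_num) (bracket_nonneg _ _ _ _))

lemma IsMultiplier.sum_thetaSq (h : IsMultiplier a C n m l) :
    ∑ i : Fin n, a i ^ 2 * (thetaSq a n m l i : ℝ) = C := by
  have h' : ∑ i : Fin n, a i ^ 2 * (thetaSq a n m l i : ℝ)
      = 1 / 2 * ∑ i : Fin n, a i ^ 2 * bracket n m l (a i) := by
    rw [Finset.mul_sum]
    exact Finset.sum_congr rfl fun i _ => by rw [coe_thetaSq]; ring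
  rw [h', h]
  ring

lemma IsMultiplier.exists_bracket_pos (h : IsMultiplier a C n m l) (hC : 0 < C) :
    ∃ i : Fin n, 0 < bracket n m l (a i) := by
  by_contra hcon
  push Not at hcon
  have h0 : ∑ i : Fin n, a i ^ 2 * bracket n m l (a i) ≤ 0 :=
    Finset.sum_nonpos fun i _ => mul_nonpos_of_nonneg_of_nonpos (sq_nonneg _) (hcon i)
  rw [h] at h0
  linarith

lemma pos_of_bracket_pos (hn : 1 ≤ n) (hm : 1 ≤ m) {b : ℝ} (h : 0 < bracket n m l b) : 0 < l := by
  have hd : 0 < (v n : ℝ) - v (n + m) := sub_pos.2 (v_add_lt hn hm)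
  have hv' : (0 : ℝ) ≤ v (n + m) := by positivity
  by_contra hl
  push Not at hl
  have hle : 1 + (4 * l / b ^ 2) / ((v n : ℝ) - v (n + m)) ≤ 1 := by
    have : (4 * l / b ^ 2) / ((v n : ℝ) - v (n + m)) ≤ 0 :=
      div_nonpos_of_nonpos_of_nonneg
        (div_nonpos_of_nonpos_of_nonneg (by linarith) (sq_nonneg _)) hd.le
    linarith
  have hsqrt : √(1 + (4 * l / b ^ 2) / ((v n : ℝ) - v (n + m))) ≤ 1 := by
    rw [← Real.sqrt_one]
    exact Real.sqrt_le_sqrt (by simpa using hle)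
  rcases lt_max_iff.1 h with h | h
  · nlinarith
  · exact lt_irrefl _ h

/-- The first-order conditions for the maximization of the Bayes risk of `N(0, S)` over the
ellipsoid: the slopes are at most `a_i ^ 2 / l`, with equality where `s_i` is positive. -/
lemma slope_thetaSq (hn : 1 ≤ n) (hm : 1 ≤ m) (hl : 0 < l) {i : Fin n} (ha : 0 < a i) :
    slope (v n) (v m) (thetaSq a n m l i) ≤ a i ^ 2 / l ∧
      (thetaSq a n m l i ≠ 0 → slope (v n) (v m) (thetaSq a n m l i) = a i ^ 2 / l) := by
  have hd : 0 < (v n : ℝ) - v (n + m) := sub_pos.2 (v_add_lt hn hm)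
  have hv : (0 : ℝ) < v n := by have := v_ne_zero hn; positivity
  have hv' : (0 : ℝ) < v (n + m) := by
    have := v_ne_zero (k := n + m) (by omega)
    positivity
  have hs0 : (0 : ℝ) ≤ thetaSq a n m l i := by positivity
  have hcoe := coe_thetaSq a n m l i
  have hiff : thetaSq a n m l i ≠ 0 ↔ (thetaSq a n m l i : ℝ) ≠ 0 := by simp
  rw [slope_v hn hm, hiff]
  set s : ℝ := (thetaSq a n m l i : ℝ)
  set x : ℝ := (v n : ℝ)
  set x' : ℝ := (v (n + m) : ℝ)
  have hR : (0 : ℝ) ≤ 1 + (4 * l / a i ^ 2) / (x - x') := by positivity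
  set R := √(1 + (4 * l / a i ^ 2) / (x - x')) with hRdef
  have hR2 : ((x - x') * R) ^ 2 = (x - x') ^ 2 + 4 * (l * (x - x') / a i ^ 2) := by
    rw [mul_pow, hRdef, Real.sq_sqrt hR]
    field_simp
  have hR0 : 0 ≤ (x - x') * R := mul_nonneg hd.le (Real.sqrt_nonneg _)
  have hmax : 2 * s = max ((x - x') * R - (x + x')) 0 := by
    rw [hcoe]
    simp only [bracket]
    ring
  have hfact : (2 * s + (x + x')) ^ 2 = (x - x') ^ 2 + 4 * ((s + x) * (s + x')) := by ring
  have hpos : 0 < (s + x) * (s + x') := by positivity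
  have hge : l * (x - x') / a i ^ 2 ≤ (s + x) * (s + x') := by
    have h1 : (x - x') * R ≤ 2 * s + (x + x') := by
      have := le_max_left ((x - x') * R - (x + x')) 0
      linarith
    have := pow_le_pow_left₀ hR0 h1 2
    linarith
  constructor
  · rw [div_le_div_iff₀ hpos hl]
    rw [div_le_iff₀ (by positivity)] at hge
    linarith
  · intro hs
    have hspos : 0 < s := lt_of_le_of_ne hs0 (Ne.symm hs)
    have heq : 2 * s + (x + x') = (x - x') * R := by
      rcases max_cases ((x - x') * R - (x + x')) 0 with h | h
      · rw [h.1] at hmax; linarith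
      · rw [h.1] at hmax; linarith
    have h2 : l * (x - x') / a i ^ 2 = (s + x) * (s + x') := by
      rw [heq] at hfact
      linarith
    rw [← h2]
    field_simp

/-- On the ellipsoid, the risk of the linear density for the prior `N(0, Ṽ)` is at most the Bayes
risk of that prior: the difference of the two is a positive multiple of this sum. -/
lemma sum_slope_thetaSq_nonpos (hn : 1 ≤ n) (hm : 1 ≤ m) (hC : 0 < C)
    (ha : ∀ i : Fin n, 0 < a i) (h : IsMultiplier a C n m l) {θ : Fin n → ℝ}
    (hθ : θ ∈ ellipsoid a C n) :
    ∑ i, slope (v n) (v m) (thetaSq a n m l i) * (θ i ^ 2 - thetaSq a n m l i) ≤ 0 := by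
  obtain ⟨j, hj⟩ := h.exists_bracket_pos hC
  have hl := pos_of_bracket_pos hn hm hj
  have hle : ∑ i, slope (v n) (v m) (thetaSq a n m l i) * (θ i ^ 2 - thetaSq a n m l i)
      ≤ ∑ i : Fin n, 1 / l * (a i ^ 2 * θ i ^ 2 - a i ^ 2 * thetaSq a n m l i) := by
    refine Finset.sum_le_sum fun i _ => ?_
    obtain ⟨h1, h2⟩ := slope_thetaSq (a := a) hn hm hl (ha i)
    have hr : 1 / l * (a i ^ 2 * θ i ^ 2 - a i ^ 2 * thetaSq a n m l i)
        = a i ^ 2 / l * (θ i ^ 2 - thetaSq a n m l i) := by ring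
    rw [hr]
    rcases eq_or_ne (thetaSq a n m l i) 0 with h0 | h0
    · rw [h0] at h1 ⊢
      exact mul_le_mul_of_nonneg_right h1 (by simpa using sq_nonneg (θ i))
    · rw [h2 h0]
  refine hle.trans ?_
  rw [← Finset.mul_sum, Finset.sum_sub_distrib, h.sum_thetaSq]
  have hθ' : ∑ i : Fin n, a i ^ 2 * θ i ^ 2 ≤ C := hθ
  exact mul_nonpos_of_nonneg_of_nonpos (by positivity) (by linarith)

/-- The Bayes risk of the prior `N(0, Ṽ)`. -/
def leastFavorableRisk (a : ℕ → ℝ) (n m : ℕ) (l : ℝ) : ℝ :=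
  1 / m * (1 / 2 * gaussInfo (v n) (v m) (thetaSq a n m l))

lemma leastFavorableRisk_pos (hn : 1 ≤ n) (hm : 1 ≤ m) (hC : 0 < C)
    (h : IsMultiplier a C n m l) : 0 < leastFavorableRisk a n m l := by
  obtain ⟨j, hj⟩ := h.exists_bracket_pos hC
  have hm' : (0 : ℝ) < m := by exact_mod_cast hm
  have hs : thetaSq a n m l j ≠ 0 := by
    intro h0
    have := coe_thetaSq a n m l j
    rw [h0] at this
    simp only [NNReal.coe_zero] at this
    linarith
  have hρ : 0 < infoRatio (v n) (v m) (thetaSq a n m l j) := by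
    have := v_ne_zero hn
    have := v_ne_zero hm
    unfold infoRatio postVar
    positivity
  have hpos : 0 < gaussInfo (v n) (v m) (thetaSq a n m l) := by
    refine Finset.sum_pos' (fun i _ => Real.log_nonneg ?_)
      ⟨j, Finset.mem_univ j, Real.log_pos (by linarith)⟩
    linarith [infoRatio_nonneg (v n) (v m) (thetaSq a n m l i)]
  unfold leastFavorableRisk
  positivity

/-! ### Comparison of the risks -/

lemma risk_linearDensity (hn : 1 ≤ n) (hm : 1 ≤ m) (s : Fin n → ℝ≥0) (θ : Fin n → ℝ) :
    risk n m θ (linearDensity n m s) = ((1 / (m : ℝ) * (1 / 2 * (gaussInfo (v n) (v m) s +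
      ∑ i, slope (v n) (v m) (s i) * (θ i ^ 2 - s i))) : ℝ) : EReal) := by
  have h := (hasKLRisk_bayesDensity (v_ne_zero hn) (v_ne_zero hm) s).klRisk_eq (v_ne_zero hm) θ
  rw [risk_eq_klRisk, EReal.coe_mul, ← h]
  rfl

lemma minimaxRisk_le_linearMinimaxRisk (hn : 1 ≤ n) (hm : 1 ≤ m) :
    minimaxRisk a C n m ≤ linearMinimaxRisk a C n m :=
  le_iInf fun s => iInf₂_le (linearDensity n m s)
    (isPredictiveDensity_bayesDensity (v_ne_zero hn) (v_ne_zero hm) s)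

lemma linearMinimaxRisk_le (hn : 1 ≤ n) (hm : 1 ≤ m) (hC : 0 < C)
    (ha : ∀ i : Fin n, 0 < a i) (h : IsMultiplier a C n m l) :
    linearMinimaxRisk a C n m ≤ (leastFavorableRisk a n m l : EReal) := by
  refine (iInf_le _ (thetaSq a n m l)).trans (iSup₂_le fun θ hθ => ?_)
  rw [risk_linearDensity hn hm]
  have := sum_slope_thetaSq_nonpos hn hm hC ha h hθ
  refine EReal.coe_le_coe_iff.2 (mul_le_mul_of_nonneg_left ?_ (by positivity))
  linarith

lemma bayesRisk_gaussPrior (hn : 1 ≤ n) (hm : 1 ≤ m) (s : Fin n → ℝ≥0) :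
    bayesRisk n m (gaussPrior s)
      = ((1 / (m : ℝ) * (1 / 2 * gaussInfo (v n) (v m) s) : ℝ) : EReal) := by
  obtain ⟨hint, hval⟩ := integral_risk_gaussPrior (r := v n) (t := v m) s
  refine le_antisymm ?_ (le_iInf₂ fun q hq => ?_)
  · refine (iInf₂_le (linearDensity n m s)
      (isPredictiveDensity_bayesDensity (v_ne_zero hn) (v_ne_zero hm) s)).trans_eq ?_
    simp_rw [risk_linearDensity hn hm]
    rw [extExpect_coe (hint.const_mul _), integral_const_mul, hval]
  · have hk := integral_le_extExpect_klRisk (v_ne_zero hn) (v_ne_zero hm)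
      (hasKLRisk_bayesDensity (v_ne_zero hn) (v_ne_zero hm) s) hint hq
      (a := 1 / (m : ℝ)) (by positivity)
    rw [hval] at hk
    exact hk

lemma maxBayesRisk_le_minimaxRisk : maxBayesRisk a C n m ≤ minimaxRisk a C n m := by
  refine iSup_le fun π => iSup₂_le fun hπ hπC => le_iInf₂ fun q hq => ?_
  refine (iInf₂_le q hq).trans ?_
  rw [← extExpect_const (μ := π) (⨆ θ ∈ ellipsoid a C n, risk n m θ q)]
  refine extExpect_mono_ae ?_
  have hae : ∀ᵐ θ ∂π, θ ∈ ellipsoid a C n :=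
    (mem_ae_iff_prob_eq_one (measurableSet_ellipsoid a C n)).2 hπC
  filter_upwards [hae] with θ hθ
  exact le_iSup₂ (f := fun θ (_ : θ ∈ ellipsoid a C n) => risk n m θ q) θ hθ

/-- The lower bound by the prior `N(0, (1 - δ) Ṽ)` conditioned on the ellipsoid. -/
lemma le_maxBayesRisk (hn : 1 ≤ n) (hm : 1 ≤ m) (hC : 0 < C) (h : IsMultiplier a C n m l)
    {δ κ ε : ℝ} (hδ : 0 < δ) (hδ1 : δ < 1) (hκ : 0 < κ)
    (hε : 2 * (∑ i : Fin n, a i ^ 4 * (thetaSq a n m l i : ℝ) ^ 2) / (δ * C) ^ 2 ≤ ε)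
    (hε2 : ε ≤ 1 / 2) (hF : 0 ≤ 1 - 3 * κ / 2 - ε / (2 * κ) - 16 * ε) :
    ((leastFavorableRisk a n m l * ((1 - δ) * (1 - 3 * κ / 2 - ε / (2 * κ) - 16 * ε)) : ℝ) : EReal)
      ≤ maxBayesRisk a C n m := by
  set c : ℝ≥0 := ⟨1 - δ, by linarith⟩
  have hc : (c : ℝ) = 1 - δ := rfl
  have hc1 : c ≤ 1 := by rw [← NNReal.coe_le_coe, hc, NNReal.coe_one]; linarith
  set s : Fin n → ℝ≥0 := fun i => c * thetaSq a n m l i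
  have hsum : ∑ i : Fin n, a i ^ 2 * (s i : ℝ) = (1 - δ) * C := by
    rw [← h.sum_thetaSq, Finset.mul_sum]
    refine Finset.sum_congr rfl fun i _ => ?_
    simp only [s, NNReal.coe_mul, hc]
    ring
  have hδC : 0 < δ * C := mul_pos hδ hC
  have hcheb := gaussPrior_compl_ellipsoid_le a (C := C) s (by rw [hsum]; linarith)
  have hsub : C - (1 - δ) * C = δ * C := by ring
  rw [hsum, hsub, probReal_compl_eq_one_sub (measurableSet_ellipsoid a C n)] at hcheb
  have hle : 2 * (∑ i : Fin n, a i ^ 4 * (s i : ℝ) ^ 2) / (δ * C) ^ 2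
      ≤ 2 * (∑ i : Fin n, a i ^ 4 * (thetaSq a n m l i : ℝ) ^ 2) / (δ * C) ^ 2 := by
    gcongr with i
    have : (c : ℝ) ≤ 1 := hc1
    simp only [s]
    exact mul_le_of_le_one_left (by positivity) this
  have hmass : 1 - (gaussPrior s).real (ellipsoid a C n) ≤ ε := hcheb.trans (hle.trans hε)
  have hP' : gaussPrior s (ellipsoid a C n) ≠ 0 := by
    intro h0
    rw [measureReal_def, h0, ENNReal.toReal_zero] at hmass
    linarith
  have hprob : IsProbabilityMeasure (gaussPrior s)[|ellipsoid a C n] :=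
    cond_isProbabilityMeasure hP'
  have hone : (gaussPrior s)[|ellipsoid a C n] (ellipsoid a C n) = 1 :=
    cond_apply_self hP' (measure_ne_top _ _)
  refine le_trans (le_iInf₂ fun q hq => ?_)
    (le_iSup_of_le (gaussPrior s)[|ellipsoid a C n] (le_iSup₂_of_le hprob hone le_rfl))
  have hlow := gaussInfo_mul_le_extExpect_cond (v_ne_zero hn) (v_ne_zero hm) s
    (measurableSet_ellipsoid a C n) hmass hε2 hκ hq (a := 1 / (m : ℝ)) (by positivity)
  refine le_trans (EReal.coe_le_coe_iff.2 ?_) hlow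
  have hinfo := mul_gaussInfo_le (t := v m) (v_ne_zero hn) hc1 (thetaSq a n m l)
  rw [hc] at hinfo
  have hinfo' := mul_le_mul_of_nonneg_right hinfo hF
  have hm' : (0 : ℝ) ≤ 1 / m := by positivity
  have := mul_le_mul_of_nonneg_left hinfo' hm'
  unfold leastFavorableRisk
  linarith

end LeastFavorable

/-! ### Ratios of extended real sequences -/

/-- A sequence of extended reals that is squeezed between `(1 - η) L` and `L`, for every `η > 0`, is
eventually real and asymptotically equivalent to `L`. -/
lemma tendsto_toReal_div {L : ℕ → ℝ} {X : ℕ → EReal} (hL : ∀ᶠ n in atTop, 0 < L n)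
    (hX : ∀ᶠ n in atTop, X n ≤ (L n : EReal))
    (hX' : ∀ η : ℝ, 0 < η → η < 1 → ∀ᶠ n in atTop, ((L n * (1 - η) : ℝ) : EReal) ≤ X n) :
    (∀ᶠ n in atTop, ((X n).toReal : EReal) = X n) ∧
      Tendsto (fun n => (X n).toReal / L n) atTop (𝓝 1) := by
  have hcoe : ∀ᶠ n in atTop, ((X n).toReal : EReal) = X n := by
    filter_upwards [hX, hX' (1 / 2) (by norm_num) (by norm_num)] with n h1 h2
    exact EReal.coe_toReal (ne_top_of_le_ne_top (EReal.coe_ne_top _) h1)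
      (ne_bot_of_le_ne_bot (EReal.coe_ne_bot _) h2)
  refine ⟨hcoe, Metric.tendsto_nhds.2 fun e he => ?_⟩
  set η := min (e / 2) (1 / 2)
  have hη : 0 < η := by positivity
  have hη1 : η < 1 := lt_of_le_of_lt (min_le_right _ _) (by norm_num)
  filter_upwards [hL, hX, hX' η hη hη1, hcoe] with n h0 h1 h2 h3
  rw [← h3] at h1 h2
  have h1' := EReal.coe_le_coe_iff.1 h1
  have h2' := EReal.coe_le_coe_iff.1 h2
  have h4 : (X n).toReal / L n ≤ 1 := (div_le_one h0).2 h1'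
  have h5 : 1 - η ≤ (X n).toReal / L n := by
    rw [le_div_iff₀ h0]; linarith
  have h6 : η ≤ e / 2 := min_le_left _ _
  rw [Real.dist_eq, abs_lt]
  constructor <;> linarith

lemma tendsto_ereal_div {L : ℕ → ℝ} {X Y : ℕ → EReal} (hL : ∀ᶠ n in atTop, 0 < L n)
    (hX : ∀ᶠ n in atTop, X n ≤ (L n : EReal))
    (hX' : ∀ η : ℝ, 0 < η → η < 1 → ∀ᶠ n in atTop, ((L n * (1 - η) : ℝ) : EReal) ≤ X n)
    (hY : ∀ᶠ n in atTop, Y n ≤ (L n : EReal))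
    (hY' : ∀ η : ℝ, 0 < η → η < 1 → ∀ᶠ n in atTop, ((L n * (1 - η) : ℝ) : EReal) ≤ Y n) :
    Tendsto (fun n => X n / Y n) atTop (𝓝 1) := by
  obtain ⟨hXc, hXt⟩ := tendsto_toReal_div hL hX hX'
  obtain ⟨hYc, hYt⟩ := tendsto_toReal_div hL hY hY'
  have ht := hXt.div hYt one_ne_zero
  rw [div_one] at ht
  have hc := (continuous_coe_real_ereal.tendsto (1 : ℝ)).comp ht
  rw [EReal.coe_one] at hc
  refine hc.congr' ?_
  filter_upwards [hL, hXc, hYc] with n h0 h1 h2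
  rw [← h1, ← h2, ← EReal.coe_div]
  simp only [Function.comp_apply, Pi.div_apply]
  rw [div_div_div_cancel_right₀ h0.ne']

end KLMinimax

end

theorem theorem4p2 (a : ℕ → ℝ) (ha_pos : 0 < a 0) (ha_mono : Monotone a)
    (ha_top : Tendsto a atTop atTop) (C : ℝ) (hC : 0 < C)
    (m : ℕ → ℕ) (hm_pos : ∀ n, 1 ≤ n → 1 ≤ m n)
    (hm : (fun n => (m n : ℝ)) =O[atTop] fun n => (n : ℝ))
    (l : ℕ → ℝ) (hl : ∀ n, 1 ≤ n → KLMinimax.IsMultiplier a C n (m n) (l n))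
    (hlog : Tendsto
      (fun n => Real.log (1 / (KLMinimax.v n : ℝ)) *
        ∑ i : Fin n, a i ^ 4 * (KLMinimax.thetaSq a n (m n) (l n) i : ℝ) ^ 2)
      atTop (𝓝 0)) :
    Tendsto (fun n => KLMinimax.minimaxRisk a C n (m n) / KLMinimax.linearMinimaxRisk a C n (m n))
        atTop (𝓝 1) ∧
      KLMinimax.AsympLeastFavorable a C m
        (fun n => KLMinimax.gaussPrior (KLMinimax.thetaSq a n (m n) (l n))) := by
  have ha : ∀ i, 0 < a i := fun i => ha_pos.trans_le (ha_mono (Nat.zero_le i))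
  set σ : ℕ → ℝ := fun n =>
    ∑ i : Fin n, a i ^ 4 * (KLMinimax.thetaSq a n (m n) (l n) i : ℝ) ^ 2
  have hσ0 : ∀ n, 0 ≤ σ n := fun n => Finset.sum_nonneg fun i _ => by
    have := ha i
    positivity
  -- The factor `log n` is at least one for `n ≥ 3`.
  have hσ : Tendsto σ atTop (𝓝 0) := by
    refine squeeze_zero' (Eventually.of_forall hσ0) ?_ hlog
    filter_upwards [eventually_ge_atTop 3] with n hn
    refine le_mul_of_one_le_left (hσ0 n) ?_
    have hn' : (3 : ℝ) ≤ n := by exact_mod_cast hn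
    rw [KLMinimax.coe_v, one_div_one_div, Real.le_log_iff_exp_le (by linarith)]
    linarith [Real.exp_one_lt_d9]
  set L : ℕ → ℝ := fun n => KLMinimax.leastFavorableRisk a n (m n) (l n)
  have hn1 : ∀ᶠ n : ℕ in atTop, 1 ≤ n := eventually_ge_atTop 1
  have hL : ∀ᶠ n in atTop, 0 < L n := hn1.mono fun n hn =>
    KLMinimax.leastFavorableRisk_pos hn (hm_pos n hn) hC (hl n hn)
  have hlow : ∀ η : ℝ, 0 < η → η < 1 → ∀ᶠ n in atTop,
      ((L n * (1 - η) : ℝ) : EReal) ≤ KLMinimax.maxBayesRisk a C n (m n) := by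
    intro η hη hη1
    -- With `δ = κ = η / 8` the bound of `le_maxBayesRisk` tends to a number above `1 - η`.
    have hε : Tendsto (fun n => 2 * σ n / (η / 8 * C) ^ 2) atTop (𝓝 0) := by
      simpa using (hσ.const_mul 2).div_const ((η / 8 * C) ^ 2)
    have hF : Tendsto (fun n => 2 * σ n / (η / 8 * C) ^ 2 / (2 * (η / 8))
        + 16 * (2 * σ n / (η / 8 * C) ^ 2)) atTop (𝓝 0) := by
      simpa using (hε.div_const (2 * (η / 8))).add (hε.const_mul 16)
    filter_upwards [hn1, hL, hε.eventually_le_const (by norm_num : (0 : ℝ) < 1 / 2),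
      hF.eventually_le_const (by positivity : 0 < η / 4)] with n hn hLn h1 h2
    refine le_trans (EReal.coe_le_coe_iff.2 (mul_le_mul_of_nonneg_left ?_ hLn.le))
      (KLMinimax.le_maxBayesRisk hn (hm_pos n hn) hC (hl n hn) (δ := η / 8) (κ := η / 8)
        (by positivity) (by linarith) (by positivity) le_rfl h1 ?_)
    · nlinarith
    · linarith
  have hmb : ∀ n, KLMinimax.maxBayesRisk a C n (m n) ≤ KLMinimax.minimaxRisk a C n (m n) :=
    fun n => KLMinimax.maxBayesRisk_le_minimaxRisk
  have hml : ∀ᶠ n in atTop,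
      KLMinimax.minimaxRisk a C n (m n) ≤ KLMinimax.linearMinimaxRisk a C n (m n) :=
    hn1.mono fun n hn => KLMinimax.minimaxRisk_le_linearMinimaxRisk hn (hm_pos n hn)
  have hlL : ∀ᶠ n in atTop, KLMinimax.linearMinimaxRisk a C n (m n) ≤ (L n : EReal) :=
    hn1.mono fun n hn =>
      KLMinimax.linearMinimaxRisk_le hn (hm_pos n hn) hC (fun i => ha i) (hl n hn)
  have hmL : ∀ᶠ n in atTop, KLMinimax.minimaxRisk a C n (m n) ≤ (L n : EReal) := by
    filter_upwards [hml, hlL] with n h1 h2 using h1.trans h2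
  have hbL : ∀ᶠ n in atTop, KLMinimax.maxBayesRisk a C n (m n) ≤ (L n : EReal) :=
    hmL.mono fun n h => (hmb n).trans h
  have hlow_m : ∀ η : ℝ, 0 < η → η < 1 → ∀ᶠ n in atTop,
      ((L n * (1 - η) : ℝ) : EReal) ≤ KLMinimax.minimaxRisk a C n (m n) :=
    fun η hη hη1 => (hlow η hη hη1).mono fun n h => h.trans (hmb n)
  have hlow_l : ∀ η : ℝ, 0 < η → η < 1 → ∀ᶠ n in atTop,
      ((L n * (1 - η) : ℝ) : EReal) ≤ KLMinimax.linearMinimaxRisk a C n (m n) := by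
    intro η hη hη1
    filter_upwards [hlow_m η hη hη1, hml] with n h1 h2 using h1.trans h2
  have hbayes : ∀ᶠ n in atTop, KLMinimax.bayesRisk n (m n)
      (KLMinimax.gaussPrior (KLMinimax.thetaSq a n (m n) (l n))) = (L n : EReal) :=
    hn1.mono fun n hn => KLMinimax.bayesRisk_gaussPrior hn (hm_pos n hn) _
  have hlow_b : ∀ η : ℝ, 0 < η → η < 1 → ∀ᶠ n in atTop,
      ((L n * (1 - η) : ℝ) : EReal) ≤ KLMinimax.bayesRisk n (m n)
        (KLMinimax.gaussPrior (KLMinimax.thetaSq a n (m n) (l n))) := by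
    intro η hη hη1
    filter_upwards [hbayes, hL] with n h1 h2
    rw [h1]
    exact EReal.coe_le_coe_iff.2 (mul_le_of_le_one_right h2.le (by linarith))
  have hbayes' := hbayes.mono fun n h => h.le
  exact ⟨KLMinimax.tendsto_ereal_div hL hmL hlow_m hlL hlow_l,
    KLMinimax.tendsto_ereal_div hL hbayes' hlow_b hmL hlow_m,
    KLMinimax.tendsto_ereal_div hL hbayes' hlow_b hbL hlow⟩
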